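/- **Theorem.** Consider a Nash equilibrium problem with $N$ players. Given $x^{-k}=(x^j)_{j\ne k}$ and $p^k=(u^k,v^k,w^k)\in\mathbb{R}^{m_k}\times\mathbb{R}^{n_k}\times\mathbb{R}^{d_k}$, player $k$ solves $$\min_{x^k\in\mathbb{R}^{n_k}} f^k(x^k,x^{-k};w^k)-\langle v^k,x^k\rangle\quad\text{s.t.}\quad g^k_i(x^k;w^k)=u^k_i\ (1\le i\le s_k),\qquad g^k_j(x^k;w^k)\le u^k_j\ (s_k<j\le m_k),$$ where $0\le s_k\le m_k$ and $f^k$, $g^k_i$ are of class $C^2$ in all their variables, including $w^k$. Write $p=(p^1,\dots,p^N)$ and $G^k=(g^k_1,\dots,g^k_{m_k})$. A local Nash equilibrium at $p$ is a point $x=(x^1,\dots,x^N)$ such that each $x^k$ is a local minimizer of player $k$'s problem for the given $x^{-k}$, $p^k$. Let $L^k(x,\lambda^k;w^k)=f^k(x;w^k)+\sum_{i=1}^{m_k}\lambda^k_i g^k_i(x^k;w^k)$, and let $S_{\rm KKT}(p)$ be the set of all $(x,\lambda)$, $\lambda=(\lambda^1,\dots,\lambda^N)$, $\lambda^k\in\mathbb{R}^{m_k}$,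 such that for all $k$ $$v^k=\nabla_{x^k}L^k(x,\lambda^k;w^k),\qquad -u^k\in -G^k(x^k;w^k)+N_{\mathbb{R}^{s_k}\times\mathbb{R}_+^{m_k-s_k}}(\lambda^k),$$ where $N_C(\lambda)$ is the normal cone to the convex set $C$ at $\lambda$ (empty if $\lambda\notin C$). Let $(\bar x,\bar\lambda)\in S_{\rm KKT}(\bar p)$, $\bar p=(\bar u,\bar v,\bar w)$. Let $I_1^k$ consist of $1,\dots,s_k$ and of all $i>s_k$ with $\bar\lambda^k_i>0=g^k_i(\bar x^k;\bar w^k)-\bar u^k_i$, and let $$M^k=\{y\in\mathbb{R}^{n_k}:\ \nabla_{x^k}g^k_i(\bar x^k;\bar w^k)^{\mathrm T}y=0\ \text{ for all } i\in I_1^k\}.$$ Let $B^k$ be a matrix whose columns form a basis of $M^k$. Let $\nabla^2_{x^kx^i}L^k$ be the $n_k\times n_i$ Jacobian with respect to $x^i$ of $\nabla_{x^k}L^k$, at $(\bar x,\bar\lambda^k;\bar w^k)$, and put $A_{ki}=\nabla^2_{x^kx^i}L^k+(\nabla^2_{x^ix^k}L^i)^{\mathrm T}$. Suppose: 1. (LICQ)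 for each $k$, the vectors $\nabla_{x^k}g^k_i(\bar x^k;\bar w^k)$ over all $i$ with $g^k_i(\bar x^k;\bar w^k)=\bar u^k_i$ are linearly independent; 2. (SSOSC) for each $k$, $y^{\mathrm T}\nabla^2_{x^kx^k}L^k\,y>0$ for all $0\ne y\in M^k$; 3. there are numbers $\alpha_{i,j}>0$ ($1\le i,j\le N$, $j\ne i$) with $\sum_{j\ne i}\alpha_{i,j}=1$ for each $i$, such that for all players $i\ne k$ and all $0\ne y\in M^k$ $$y^{\mathrm T}\Big(\nabla^2_{x^kx^k}L^k-\frac{1}{4\alpha_{i,k}\alpha_{k,i}}A_{ik}^{\mathrm T}B^i\big((B^i)^{\mathrm T}\nabla^2_{x^ix^i}L^iB^i\big)^{-1}(B^i)^{\mathrm T}A_{ik}\Big)y>0.$$ If $N=1$, condition 3 is void. Then $S_{\rm KKT}$ is strongly regular at $\bar p$ for $(\bar x,\bar\lambda)$, that is, there are neighbourhoods $U$ of $\bar p$ and $V$ of $(\bar x,\bar\lambda)$ such that $\operatorname{gph}S_{\rm KKT}\cap(U\times V)$ is the graph of a Lipschitz continuous function $U\to V$. Moreover, there is a neighbourhood of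 $(\bar p,\bar x,\bar\lambda)$ such that for every $(p,x,\lambda)\in\operatorname{gph}S_{\rm KKT}$ in it, $x$ is a local Nash equilibrium at $p$. -/

import Mathlib

open Topology Filter
open scoped InnerProductSpace Matrix Gradient

noncomputable section

/-- The normal cone of convex analysis to a set `C` at `x`; it is empty when `x ∉ C`. -/
def normalCone {E : Type*} [NormedAddCommGroup E] [InnerProductSpace ℝ E]
    (C : Set E) (x : E) : Set E :=
  {v | x ∈ C ∧ ∀ y ∈ C, ⟪v, y - x⟫_ℝ ≤ 0}

/-- The cone `ℝ^s × ℝ₊^(m-s)` inside `ℝ^m`: the coordinates from index `s` on are nonnegative. -/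
def multiplierCone (m s : ℕ) : Set (EuclideanSpace ℝ (Fin m)) :=
  {l | ∀ i : Fin m, s ≤ (i : ℕ) → 0 ≤ l i}

/-- A set-valued mapping `Φ : A ⇉ B` has a Lipschitz continuous single-valued localization around
`a` for `b`: `b ∈ Φ a`, and for some neighbourhoods `U` of `a` and `V` of `b` the set
`gph Φ ∩ (U × V)` is the graph of a Lipschitz function `σ : U → V`. -/
def StronglyRegular {A B : Type*} [PseudoMetricSpace A] [PseudoMetricSpace B]
    (Φ : A → Set B) (a : A) (b : B) : Prop :=
  b ∈ Φ a ∧ ∃ U ∈ 𝓝 a, ∃ V ∈ 𝓝 b, ∃ σ : A → B,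
    (∀ a' ∈ U, Φ a' ∩ V = {σ a'}) ∧ ∃ K : NNReal, LipschitzOnWith K σ U

/-- A Nash equilibrium problem with `N` players. Player `k` has strategies in `ℝ^(n k)`, a `C²`
objective `f k (x, w)` depending on all strategies and on a parameter `w ∈ ℝ^(d k)`, and `m k`
constraint functions `g k i (x^k, w)` of class `C²`; the first `s k` constraints are equalities and
the others are inequalities. -/
structure NEP where
  N : ℕ
  n : Fin N → ℕ
  m : Fin N → ℕ
  s : Fin N → ℕ
  d : Fin N → ℕ
  s_le : ∀ k, s k ≤ m k
  f : ∀ k, (∀ j, EuclideanSpace ℝ (Fin (n j))) → EuclideanSpace ℝ (Fin (d k)) → ℝ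
  g : ∀ k, Fin (m k) → EuclideanSpace ℝ (Fin (n k)) → EuclideanSpace ℝ (Fin (d k)) → ℝ
  f_contDiff : ∀ k, ContDiff ℝ 2
    (fun z : (∀ j, EuclideanSpace ℝ (Fin (n j))) × EuclideanSpace ℝ (Fin (d k)) => f k z.1 z.2)
  g_contDiff : ∀ k i, ContDiff ℝ 2
    (fun z : EuclideanSpace ℝ (Fin (n k)) × EuclideanSpace ℝ (Fin (d k)) => g k i z.1 z.2)

namespace NEP

variable (G : NEP)

/-- Strategy profiles `x = (x^1, …, x^N)`. -/
abbrev Strategy : Type := ∀ k : Fin G.N, EuclideanSpace ℝ (Fin (G.n k))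

/-- Multipliers `λ = (λ^1, …, λ^N)`. -/
abbrev Multiplier : Type := ∀ k : Fin G.N, EuclideanSpace ℝ (Fin (G.m k))

/-- The perturbation parameter `p^k = (u^k, v^k, w^k)` of player `k`. -/
abbrev PlayerParam (k : Fin G.N) : Type :=
  EuclideanSpace ℝ (Fin (G.m k)) × EuclideanSpace ℝ (Fin (G.n k)) × EuclideanSpace ℝ (Fin (G.d k))

/-- Perturbation parameters `p = (p^1, …, p^N)`. -/
abbrev Param : Type := ∀ k : Fin G.N, G.PlayerParam k

variable {G}

/-- The component `u^k`. -/
def u (p : G.Param) (k : Fin G.N) : EuclideanSpace ℝ (Fin (G.m k)) := (p k).1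

/-- The component `v^k`. -/
def v (p : G.Param) (k : Fin G.N) : EuclideanSpace ℝ (Fin (G.n k)) := (p k).2.1

/-- The component `w^k`. -/
def w (p : G.Param) (k : Fin G.N) : EuclideanSpace ℝ (Fin (G.d k)) := (p k).2.2

/-- The feasible set of player `k` at the perturbation `p`. -/
def feasible (p : G.Param) (k : Fin G.N) : Set (EuclideanSpace ℝ (Fin (G.n k))) :=
  {y | ∀ i : Fin (G.m k),
    ((i : ℕ) < G.s k → G.g k i y (w p k) = u p k i) ∧
    (G.s k ≤ (i : ℕ) → G.g k i y (w p k) ≤ u p k i)}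

/-- The objective of player `k` as a function of the own strategy `y`, the strategies of the other
players being those of `x`. -/
def objective (p : G.Param) (x : G.Strategy) (k : Fin G.N) (y : EuclideanSpace ℝ (Fin (G.n k))) :
    ℝ :=
  G.f k (Function.update x k y) (w p k) - ⟪v p k, y⟫_ℝ

/-- `x` is a local Nash equilibrium at `p`: each `x^k` is a local minimizer of player `k`'s problem,
given the strategies of the other players. -/
def IsLocalNash (p : G.Param) (x : G.Strategy) : Prop :=
  ∀ k, x k ∈ feasible p k ∧ IsLocalMinOn (objective p x k) (feasible p k) (x k)

/-- The Lagrangian `L^k(x, λ^k; w^k)` of player `k`. -/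
def lagrangian (k : Fin G.N) (x : G.Strategy) (l : EuclideanSpace ℝ (Fin (G.m k)))
    (w : EuclideanSpace ℝ (Fin (G.d k))) : ℝ :=
  G.f k x w + ∑ i, l i * G.g k i (x k) w

/-- The partial gradient `∇_{x^k} L^k(x, λ^k; w^k)`. -/
def gradL (k : Fin G.N) (x : G.Strategy) (l : EuclideanSpace ℝ (Fin (G.m k)))
    (w : EuclideanSpace ℝ (Fin (G.d k))) : EuclideanSpace ℝ (Fin (G.n k)) :=
  ∇ (fun y => lagrangian k (Function.update x k y) l w) (x k)

/-- The `n_k × n_i` matrix `∇²_{x^k x^i} L^k(x, λ^k; w^k)`, the partial Jacobian with respect to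
`x^i` of `∇_{x^k} L^k`. -/
def hessL (k i : Fin G.N) (x : G.Strategy) (l : EuclideanSpace ℝ (Fin (G.m k)))
    (w : EuclideanSpace ℝ (Fin (G.d k))) : Matrix (Fin (G.n k)) (Fin (G.n i)) ℝ :=
  Matrix.of fun a b =>
    fderiv ℝ (fun z => gradL k (Function.update x i z) l w) (x i) (EuclideanSpace.single b 1) a

/-- The vector `G^k(x^k; w^k)` of constraint values of player `k`. -/
def constraintVec (k : Fin G.N) (y : EuclideanSpace ℝ (Fin (G.n k)))
    (w : EuclideanSpace ℝ (Fin (G.d k))) : EuclideanSpace ℝ (Fin (G.m k)) :=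
  WithLp.toLp 2 fun i => G.g k i y w

variable (G) in
/-- The KKT solution mapping `S_KKT`: `(x, λ) ∈ S_KKT(p)` if for every player `k` one has
`v^k = ∇_{x^k} L^k` and `-u^k ∈ -G^k + N(λ^k)`. -/
def SKKT (p : G.Param) : Set (G.Strategy × G.Multiplier) :=
  {q | ∀ k, v p k = gradL k q.1 (q.2 k) (w p k) ∧
    ∃ η ∈ normalCone (multiplierCone (G.m k) (G.s k)) (q.2 k),
      -u p k = -constraintVec k (q.1 k) (w p k) + η}

/-- The gradient `∇_{x^k} g^k_i(x^k; w^k)`. -/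
def gradg (p : G.Param) (x : G.Strategy) (k : Fin G.N) (i : Fin (G.m k)) :
    EuclideanSpace ℝ (Fin (G.n k)) :=
  ∇ (fun y => G.g k i y (w p k)) (x k)

/-- The indices of the constraints of player `k` that are active at `x^k`
(all equality constraints are). -/
def activeSet (p : G.Param) (x : G.Strategy) (k : Fin G.N) : Set (Fin (G.m k)) :=
  {i | (i : ℕ) < G.s k ∨ G.g k i (x k) (w p k) = u p k i}

/-- The linear independence constraint qualification for player `k`. -/
def LICQ (p : G.Param) (x : G.Strategy) (k : Fin G.N) : Prop :=
  LinearIndependent ℝ (fun i : activeSet p x k => gradg p x k i)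

/-- The index set `I₁^k`: equality constraints, and active inequality constraints with a positive
multiplier. -/
def I₁ (p : G.Param) (x : G.Strategy) (l : G.Multiplier) (k : Fin G.N) : Set (Fin (G.m k)) :=
  {i | (i : ℕ) < G.s k ∨
    (G.s k ≤ (i : ℕ) ∧ 0 < l k i ∧ G.g k i (x k) (w p k) - u p k i = 0)}

/-- The subspace `M^k` of all `y` orthogonal to `∇ g^k_i` for `i ∈ I₁^k`. -/
def M (p : G.Param) (x : G.Strategy) (l : G.Multiplier) (k : Fin G.N) :
    Submodule ℝ (EuclideanSpace ℝ (Fin (G.n k))) where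
  carrier := {y | ∀ i ∈ I₁ p x l k, ⟪gradg p x k i, y⟫_ℝ = 0}
  add_mem' := by
    intro a b ha hb i hi
    rw [inner_add_right, ha i hi, hb i hi, add_zero]
  zero_mem' := by
    intro i _
    exact inner_zero_right _
  smul_mem' := by
    intro c a ha i hi
    rw [inner_smul_right, ha i hi, mul_zero]

/-- The block `∇²_{x^k x^i} L^k` at `(x, λ^k; w^k)`. -/
def H (p : G.Param) (x : G.Strategy) (l : G.Multiplier) (k i : Fin G.N) :
    Matrix (Fin (G.n k)) (Fin (G.n i)) ℝ :=
  hessL k i x (l k) (w p k)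

/-- The strong second-order sufficient condition for player `k`. -/
def SSOSC (p : G.Param) (x : G.Strategy) (l : G.Multiplier) (k : Fin G.N) : Prop :=
  ∀ y ∈ M p x l k, y ≠ 0 → 0 < y.ofLp ⬝ᵥ (H p x l k k *ᵥ y.ofLp)

/-- The matrix `A_{ki} = ∇²_{x^k x^i} L^k + (∇²_{x^i x^k} L^i)ᵀ`. -/
def A (p : G.Param) (x : G.Strategy) (l : G.Multiplier) (k i : Fin G.N) :
    Matrix (Fin (G.n k)) (Fin (G.n i)) ℝ :=
  H p x l k i + (H p x l i k)ᵀ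

/-- The matrix whose columns are the members of a basis of a subspace of `ℝ^n`. -/
def basisMatrix {n r : ℕ} {S : Submodule ℝ (EuclideanSpace ℝ (Fin n))}
    (b : Module.Basis (Fin r) ℝ S) : Matrix (Fin n) (Fin r) ℝ :=
  Matrix.of fun a c => (b c : EuclideanSpace ℝ (Fin n)) a

/-- The matrix `∇²_{x^k x^k} L^k - (4 α_{ik} α_{ki})⁻¹ A_{ik}ᵀ B ((Bᵀ ∇²_{x^i x^i} L^i B)⁻¹) Bᵀ A_{ik}`,
where `B` is the basis matrix of player `i`. -/
def schur (p : G.Param) (x : G.Strategy) (l : G.Multiplier) (α : Fin G.N → Fin G.N → ℝ)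
    (i k : Fin G.N) {r : ℕ} (B : Matrix (Fin (G.n i)) (Fin r) ℝ) :
    Matrix (Fin (G.n k)) (Fin (G.n k)) ℝ :=
  H p x l k k - (1 / (4 * α i k * α k i)) •
    ((A p x l i k)ᵀ * B * (Bᵀ * H p x l i i * B)⁻¹ * Bᵀ * A p x l i k)

end NEP

end

/-! Take the slacks e^k = G^k - u^k as extra unknowns. The KKT conditions become a C¹ equation in
(p; x, λ, e) together with sign and complementarity conditions on (λ, e). Near the reference point
the latter say that the increment of (x, λ, e) lies in a fixed polyhedral, generally nonconvex cone
(`eventually_sub_mem_complementarityCone_iff`). By a contraction argument in Robinson's style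
(`exists_lipschitz_localization`) it then suffices that the linearization T of the equation,
restricted to this cone, is a bijection with Lipschitz inverse.

Differences of cone elements (y, μ, η) satisfy μ_j η_j ≥ 0. If T(y, μ, η) = 0 for such a triple,
pairing the stationarity rows with y gives ∑ ⟨y^k, H^k y⟩ = -∑ μ_j η_j ≤ 0, where H^k is the
derivative of ∇_{x^k} L^k in the whole profile, while η = 0 on I₁ puts y^k in M^k. Positive
definiteness of the game Jacobian on ∏ M^k forces y = 0, hence η = 0, and LICQ gives μ = 0.
Compactness turns this into a uniform lower bound for T, hence injectivity and the Lipschitz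
constant. For surjectivity, the cone is parametrized piecewise linearly by (y, μ + η) and deformed
to a linear parametrization, the same bound holding all along
(`exists_lipschitz_inverse_on_complementarityCone`).

Positive definiteness (`sum_inner_hessOp_pos`) is where condition 3 enters: the weights α distribute
each player's own quadratic form over the opponents, and for each pair completing the square in one
strategy leaves the Schur-type form assumed positive.

The Nash property needs only SSOSC. Penalizing the constraints in I₁ makes the Hessian of the
Lagrangian definite on the whole space, so nearby stationary points of the augmented Lagrangian
minimize it on a fixed ball; on feasible points close to a KKT point it lies below the objective up
to a constant, with equality at the KKT point (`eventually_isLocalMinOn`). -/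

/-! ### Coercivity, the continuity method and a Robinson-type implicit function theorem -/

/-- A continuous positively homogeneous function that is positive on a closed cone minus the origin
is bounded below by a multiple of the corresponding power of the norm. -/
theorem exists_pos_mul_norm_pow_le {E : Type*} [NormedAddCommGroup E] [NormedSpace ℝ E]
    [FiniteDimensional ℝ E] {C : Set E} (hC : IsClosed C)
    (hcone : ∀ t : ℝ, 0 ≤ t → ∀ x ∈ C, t • x ∈ C) {φ : E → ℝ} (hφ : Continuous φ) (n : ℕ)
    (hhom : ∀ t : ℝ, 0 ≤ t → ∀ x, φ (t • x) = t ^ n * φ x) (hn : n ≠ 0)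
    (hpos : ∀ x ∈ C, x ≠ 0 → 0 < φ x) :
    ∃ c : ℝ, 0 < c ∧ ∀ x ∈ C, c * ‖x‖ ^ n ≤ φ x := by
  have hK : IsCompact (Metric.sphere (0 : E) 1 ∩ C) := (isCompact_sphere 0 1).inter_right hC
  obtain ⟨c, hc, hcK⟩ : ∃ c : ℝ, 0 < c ∧ ∀ x ∈ Metric.sphere (0 : E) 1 ∩ C, c ≤ φ x := by
    rcases (Metric.sphere (0 : E) 1 ∩ C).eq_empty_or_nonempty with h | h
    · exact ⟨1, one_pos, by simp [h]⟩
    · obtain ⟨x, hx, hmin⟩ := hK.exists_isMinOn h hφ.continuousOn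
      refine ⟨φ x, hpos x hx.2 ?_, fun y hy => hmin hy⟩
      rintro rfl
      simpa using hx.1
  refine ⟨c, hc, fun x hx => ?_⟩
  rcases eq_or_ne x 0 with rfl | h0
  · have := hhom 0 le_rfl 0
    simp [hn] at this
    simp [hn, this]
  · have hnx : 0 < ‖x‖ := norm_pos_iff.2 h0
    have h1 := hcK (‖x‖⁻¹ • x) ⟨by simp [norm_smul, hnx.ne'], hcone _ (by positivity) x hx⟩
    rw [hhom _ (by positivity), inv_pow] at h1
    have hp : 0 < ‖x‖ ^ n := by positivity
    calc c * ‖x‖ ^ n ≤ ((‖x‖ ^ n)⁻¹ * φ x) * ‖x‖ ^ n := by gcongr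
      _ = φ x := by field_simp

/-- A Lipschitz perturbation, small with respect to the expansion constant, of a surjective
expanding map is surjective. -/
theorem surjective_add_of_expanding {E F : Type*} [NormedAddCommGroup E] [CompleteSpace E]
    [NormedAddCommGroup F] {Φ β : E → F} {c K : ℝ} (hc : 0 < c) (hK : 0 ≤ K) (hKc : K < c)
    (hΦ : Function.Surjective Φ) (hexp : ∀ x y, c * ‖x - y‖ ≤ ‖Φ x - Φ y‖)
    (hβ : ∀ x y, ‖β x - β y‖ ≤ K * ‖x - y‖) :
    Function.Surjective fun x => Φ x + β x := by
  intro y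
  choose Ψ hΨ using hΦ
  -- Expansion makes any right inverse `Ψ` Lipschitz with constant 1/c, so x ↦ Ψ(y - β x) contracts
  -- by K/c; its fixed point solves the equation.
  have hlip : LipschitzWith (Real.toNNReal (K / c)) fun x => Ψ (y - β x) := by
    refine LipschitzWith.of_dist_le_mul fun a b => ?_
    rw [Real.coe_toNNReal _ (by positivity), dist_eq_norm, dist_eq_norm, div_mul_eq_mul_div,
      le_div_iff₀ hc, mul_comm]
    refine (hexp _ _).trans ?_
    rw [hΨ, hΨ, sub_sub_sub_cancel_left, norm_sub_rev a b]
    exact hβ b a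
  have hcontr : ContractingWith (Real.toNNReal (K / c)) fun x => Ψ (y - β x) :=
    ⟨by rw [Real.toNNReal_lt_one, div_lt_one hc]; exact hKc, hlip⟩
  obtain ⟨x, hx⟩ : ∃ x, Ψ (y - β x) = x :=
    have : Nonempty E := ⟨0⟩
    ⟨_, hcontr.fixedPoint_isFixedPt⟩
  refine ⟨x, ?_⟩
  have h := hΨ (y - β x)
  rw [hx] at h
  simp [h]

/-- The method of continuity for Lipschitz homotopies of uniformly expanding maps. -/
theorem surjective_of_homotopy_expanding {E F : Type*} [NormedAddCommGroup E] [CompleteSpace E]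
    [NormedAddCommGroup F] [NormedSpace ℝ F] {Φ β : E → F} {c K : ℝ} (hc : 0 < c) (hK : 0 ≤ K)
    (hΦ : Function.Surjective Φ)
    (hexp : ∀ t ∈ Set.Icc (0 : ℝ) 1, ∀ x y,
      c * ‖x - y‖ ≤ ‖(Φ x + t • β x) - (Φ y + t • β y)‖)
    (hβ : ∀ x y, ‖β x - β y‖ ≤ K * ‖x - y‖) :
    Function.Surjective fun x => Φ x + β x := by
  -- With n > K/c each increment of the homotopy has Lipschitz constant K/n < c, so surjectivity
  -- passes from one step to the next.
  obtain ⟨n, hn⟩ := exists_nat_gt (K / c)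
  have hn0 : (0 : ℝ) < n := lt_of_le_of_lt (by positivity) hn
  have key : ∀ j : ℕ, j ≤ n → Function.Surjective fun x => Φ x + ((j : ℝ) / n) • β x := by
    intro j
    induction j with
    | zero => intro _; simpa using hΦ
    | succ j ih =>
      intro hj
      have hj' : (j : ℝ) ≤ n := by exact_mod_cast (Nat.le_succ j).trans hj
      have h := surjective_add_of_expanding (K := K / n) (β := fun x => ((1 : ℝ) / n) • β x) hc
        (by positivity) ?_ (ih ((Nat.le_succ j).trans hj))
        (hexp _ ⟨by positivity, (div_le_one hn0).2 hj'⟩) ?_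
      · convert h using 2 with x
        rw [add_assoc, ← add_smul]
        congr 2
        push_cast
        ring
      · rw [div_lt_iff₀ hn0]
        rw [div_lt_iff₀ hc] at hn
        linarith
      · intro x y
        rw [← smul_sub, norm_smul, Real.norm_of_nonneg (by positivity)]
        calc 1 / (n : ℝ) * ‖β x - β y‖ ≤ 1 / (n : ℝ) * (K * ‖x - y‖) := by gcongr; exact hβ x y
          _ = K / n * ‖x - y‖ := by ring
  have := key n le_rfl
  simpa [div_self hn0.ne'] using this

/-- An implicit function theorem for inclusions `q - q₀ ∈ C`, `N (p, q) = 0`: if the linearization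
`T` of `N` in `q` is inverted on `C` by a Lipschitz map `Ψ`, the solution mapping has a Lipschitz
single-valued localization. -/
theorem exists_lipschitz_localization {P Q Y : Type*} [NormedAddCommGroup P] [NormedSpace ℝ P]
    [NormedAddCommGroup Q] [NormedSpace ℝ Q] [CompleteSpace Q]
    [NormedAddCommGroup Y] [NormedSpace ℝ Y]
    {N : P × Q → Y} {D : P × Q →L[ℝ] Y} {p₀ : P} {q₀ : Q} (hN : HasStrictFDerivAt N D (p₀, q₀))
    (hN₀ : N (p₀, q₀) = 0) {C : Set Q} {Ψ : Y → Q} {K : ℝ} (hK : 0 < K)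
    (hΨ : ∀ y y', ‖Ψ y - Ψ y'‖ ≤ K * ‖y - y'‖) (hΨC : ∀ y, Ψ y ∈ C)
    (hTΨ : ∀ y, D (0, Ψ y) = y) (hΨT : ∀ q ∈ C, Ψ (D (0, q)) = q) (hC : (0 : Q) ∈ C)
    {W : Set Q} (hW : W ∈ 𝓝 q₀) :
    ∃ U ∈ 𝓝 p₀, ∃ V ∈ 𝓝 q₀, V ⊆ W ∧ ∃ σ : P → Q,
      (∀ p ∈ U, {q | q - q₀ ∈ C ∧ N (p, q) = 0} ∩ V = {σ p}) ∧
      ∃ L : NNReal, LipschitzOnWith L σ U := by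
  classical
  -- The linearization error ε is chosen so that the iteration below contracts by K ε = 1/2 in q.
  obtain ⟨ε, hε, hεK⟩ : ∃ ε : ℝ, 0 < ε ∧ K * ε = 1 / 2 := ⟨1 / (2 * K), by positivity, by field_simp⟩
  have happ := hN.isLittleO.def hε
  rw [nhds_prod_eq, Filter.eventually_prod_iff] at happ
  obtain ⟨A, hA, B, hB, hAB⟩ := happ
  obtain ⟨ρ, hρ, hρAB⟩ := Metric.eventually_nhds_iff_ball.1 (hA.and hB)
  obtain ⟨ρ', hρ', hρW⟩ := Metric.mem_nhds_iff.1 hW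
  set S : ℝ := ‖D‖ with hS
  obtain ⟨R, hR, hRρ, hRρ'⟩ : ∃ R : ℝ, 0 < R ∧ R < ρ ∧ R < ρ' :=
    ⟨min ρ ρ' / 2, by positivity, by linarith [min_le_left ρ ρ', lt_min hρ hρ'],
      by linarith [min_le_right ρ ρ', lt_min hρ hρ']⟩
  -- A Newton-type map: its fixed points are exactly the solutions, because `Ψ` inverts the
  -- linearization on C.
  set Θ : P → Q → Q := fun p q => q₀ + Ψ (D (0, q - q₀) - N (p, q)) with hΘ
  have hest : ∀ p ∈ Metric.ball p₀ ρ, ∀ p' ∈ Metric.ball p₀ ρ, ∀ q ∈ Metric.closedBall q₀ R,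
      ∀ q' ∈ Metric.closedBall q₀ R,
      ‖Θ p q - Θ p' q'‖ ≤ K * (S + ε) * ‖p - p'‖ + 1 / 2 * ‖q - q'‖ := by
    intro p hp p' hp' q hq q' hq'
    have hm : ∀ a ∈ Metric.ball p₀ ρ, ∀ b ∈ Metric.closedBall q₀ R,
        (a, b) ∈ Metric.ball (p₀, q₀) ρ := by
      intro a ha b hb
      rw [Metric.mem_ball, Prod.dist_eq]
      exact max_lt ha (lt_of_le_of_lt hb hRρ)
    have h := hAB (hρAB _ (hm p hp q hq)).1 (hρAB _ (hm p' hp' q' hq')).2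
    simp only at h
    have h1 : (D (0, q - q₀) - N (p, q)) - (D (0, q' - q₀) - N (p', q')) =
        -(N (p, q) - N (p', q') - D ((p, q) - (p', q'))) - D (p - p', 0) := by
      have : D ((p, q) - (p', q')) = D (p - p', 0) + (D (0, q - q₀) - D (0, q' - q₀)) := by
        rw [← map_sub, ← map_add]; simp
      rw [this]; abel
    have h2 : ‖D (p - p', 0)‖ ≤ S * ‖p - p'‖ := by
      refine (D.le_opNorm _).trans ?_
      rw [Prod.norm_mk]; simp [hS]
    have h3 : ‖(p, q) - (p', q')‖ ≤ ‖p - p'‖ + ‖q - q'‖ := by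
      rw [Prod.mk_sub_mk, Prod.norm_mk]
      exact max_le_add_of_nonneg (norm_nonneg _) (norm_nonneg _)
    calc ‖Θ p q - Θ p' q'‖ = ‖Ψ (D (0, q - q₀) - N (p, q)) - Ψ (D (0, q' - q₀) - N (p', q'))‖ := by
          simp [hΘ]
      _ ≤ K * ‖(D (0, q - q₀) - N (p, q)) - (D (0, q' - q₀) - N (p', q'))‖ := hΨ _ _
      _ ≤ K * (ε * (‖p - p'‖ + ‖q - q'‖) + S * ‖p - p'‖) := by
          rw [h1]
          gcongr
          refine (norm_sub_le _ _).trans ?_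
          rw [norm_neg]
          exact add_le_add (h.trans (by gcongr)) h2
      _ = K * (S + ε) * ‖p - p'‖ + (K * ε) * ‖q - q'‖ := by ring
      _ = _ := by rw [hεK]
  have hΨ0 : Ψ 0 = 0 := by simpa [Prod.mk_zero_zero] using hΨT 0 hC
  have hΘ0 : Θ p₀ q₀ = q₀ := by simp [hΘ, hN₀, hΨ0, Prod.mk_zero_zero]
  have hfix : ∀ p q, (q - q₀ ∈ C ∧ N (p, q) = 0) ↔ Θ p q = q := by
    intro p q
    constructor
    · rintro ⟨h1, h2⟩
      simp [hΘ, h2, hΨT _ h1]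
    · intro h
      have h1 : q - q₀ = Ψ (D (0, q - q₀) - N (p, q)) := by
        rw [sub_eq_iff_eq_add']; exact h.symm
      refine ⟨h1 ▸ hΨC _, ?_⟩
      have h2 := hTΨ (D (0, q - q₀) - N (p, q))
      rw [← h1] at h2
      exact sub_eq_self.1 h2.symm
  have hSe : 0 < K * (S + ε) := by positivity
  -- Moving p by δ displaces the image of the centre by at most R/2; the contraction uses up the
  -- other R/2 of the ball.
  set δ : ℝ := min ρ (R / (2 * (K * (S + ε)))) with hδ
  have hδ0 : 0 < δ := lt_min hρ (by positivity)
  have hδ1 : ∀ p ∈ Metric.ball p₀ δ, p ∈ Metric.ball p₀ ρ := fun p hp =>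
    Metric.ball_subset_ball (min_le_left _ _) hp
  have hself : ∀ p ∈ Metric.ball p₀ δ, Set.MapsTo (Θ p) (Metric.closedBall q₀ R)
      (Metric.closedBall q₀ R) := by
    intro p hp q hq
    have h := hest p (hδ1 p hp) p₀ (Metric.mem_ball_self hρ) q hq q₀
      (Metric.mem_closedBall_self hR.le)
    rw [hΘ0] at h
    rw [mem_closedBall_iff_norm] at hq ⊢
    have h4 : K * (S + ε) * ‖p - p₀‖ ≤ R / 2 := by
      have : ‖p - p₀‖ ≤ R / (2 * (K * (S + ε))) :=
        (mem_ball_iff_norm.1 hp).le.trans (min_le_right _ _)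
      calc _ ≤ K * (S + ε) * (R / (2 * (K * (S + ε)))) := by gcongr
        _ = R / 2 := by
          generalize K * (S + ε) = x at hSe
          field_simp
    linarith
  have hex : ∀ p ∈ Metric.ball p₀ δ, ∃ q ∈ Metric.closedBall q₀ R, Θ p q = q := by
    intro p hp
    have hcon : ContractingWith (1 / 2) ((hself p hp).restrict (Θ p) _ _) := by
      refine ⟨by norm_num, LipschitzWith.of_dist_le_mul fun a b => ?_⟩
      rw [Subtype.dist_eq, Subtype.dist_eq, dist_eq_norm, dist_eq_norm]
      have := hest p (hδ1 p hp) p (hδ1 p hp) a a.2 b b.2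
      simpa using this
    obtain ⟨y, hy, hyfix, -⟩ := ContractingWith.exists_fixedPoint'
      (Metric.isClosed_closedBall.isComplete) (hself p hp) hcon
      (Metric.mem_closedBall_self hR.le) (edist_ne_top _ _)
    exact ⟨y, hy, hyfix⟩
  choose! σ hσ hσfix using hex
  have hlip : ∀ p ∈ Metric.ball p₀ δ, ∀ p' ∈ Metric.ball p₀ δ, ∀ q ∈ Metric.closedBall q₀ R,
      ∀ q' ∈ Metric.closedBall q₀ R, Θ p q = q → Θ p' q' = q' →
      ‖q - q'‖ ≤ 2 * (K * (S + ε)) * ‖p - p'‖ := by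
    intro p hp p' hp' q hq q' hq' h h'
    have := hest p (hδ1 p hp) p' (hδ1 p' hp') q hq q' hq'
    rw [h, h'] at this
    linarith
  refine ⟨Metric.ball p₀ δ, Metric.ball_mem_nhds _ hδ0, Metric.closedBall q₀ R,
    Metric.closedBall_mem_nhds _ hR, (Metric.closedBall_subset_ball hRρ').trans hρW, σ, ?_,
    Real.toNNReal (2 * (K * (S + ε))), ?_⟩
  · intro p hp
    ext q
    simp only [Set.mem_inter_iff, Set.mem_ofPred_eq, hfix, Set.mem_singleton_iff]
    constructor
    · rintro ⟨h, hq⟩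
      have := hlip p hp p hp q hq (σ p) (hσ p hp) h (hσfix p hp)
      rw [sub_self, norm_zero, mul_zero] at this
      exact sub_eq_zero.1 (norm_le_zero_iff.1 this)
    · rintro rfl
      exact ⟨hσfix p hp, hσ p hp⟩
  · refine LipschitzOnWith.of_dist_le_mul fun p hp p' hp' => ?_
    rw [Real.coe_toNNReal _ (by positivity), dist_eq_norm, dist_eq_norm]
    exact hlip p hp p' hp' _ (hσ p hp) _ (hσ p' hp') (hσfix p hp) (hσfix p' hp')

/-! ### The complementarity cone and its differences -/

theorem norm_pi_euclideanSpace_le {ι : Type*} [Fintype ι] {m : ι → ℕ}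
    {x y : ∀ k, EuclideanSpace ℝ (Fin (m k))} (h : ∀ k j, |x k j| ≤ |y k j|) : ‖x‖ ≤ ‖y‖ := by
  refine (pi_norm_le_iff_of_nonneg (norm_nonneg _)).2 fun k => le_trans ?_ (norm_le_pi_norm y k)
  rw [EuclideanSpace.norm_eq, EuclideanSpace.norm_eq]
  exact Real.sqrt_le_sqrt (Finset.sum_le_sum fun j _ => by
    simpa using sq_le_sq.2 (h k j))

/-- The tangent cone of the graph of the normal cone mapping: `η` vanishes on `I₁`, `μ` vanishes on
`I₂`, and on the remaining indices the pair is complementary. -/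
def complementarityCone {ι : Type*} (X : Type*) {m : ι → ℕ} (I₁ I₂ : ∀ k, Set (Fin (m k))) :
    Set (X × (∀ k, EuclideanSpace ℝ (Fin (m k))) × (∀ k, EuclideanSpace ℝ (Fin (m k)))) :=
  {q | ∀ k j, (j ∈ I₁ k → q.2.2 k j = 0) ∧ (j ∈ I₂ k → q.2.1 k j = 0) ∧
    (j ∉ I₁ k → j ∉ I₂ k → 0 ≤ q.2.1 k j ∧ q.2.2 k j ≤ 0 ∧ q.2.1 k j * q.2.2 k j = 0)}

/-- A cone containing all differences of elements of `complementarityCone`. -/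
def monotoneCone {ι : Type*} (X : Type*) {m : ι → ℕ} (I₁ I₂ : ∀ k, Set (Fin (m k))) :
    Set (X × (∀ k, EuclideanSpace ℝ (Fin (m k))) × (∀ k, EuclideanSpace ℝ (Fin (m k)))) :=
  {q | ∀ k j, (j ∈ I₁ k → q.2.2 k j = 0) ∧ (j ∈ I₂ k → q.2.1 k j = 0) ∧
    0 ≤ q.2.1 k j * q.2.2 k j}

/-- On the remaining indices μη = μ'η' = 0, so (μ - μ')(η - η') = -μη' - μ'η, which is nonnegative
by the sign conditions. -/
theorem sub_mem_monotoneCone {ι X : Type*} [AddCommGroup X] {m : ι → ℕ}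
    {I₁ I₂ : ∀ k, Set (Fin (m k))} {q q' : X × (∀ k, EuclideanSpace ℝ (Fin (m k))) ×
      (∀ k, EuclideanSpace ℝ (Fin (m k)))}
    (h : q ∈ complementarityCone X I₁ I₂) (h' : q' ∈ complementarityCone X I₁ I₂) :
    q - q' ∈ monotoneCone X I₁ I₂ := by
  intro k j
  obtain ⟨h1, h2, h3⟩ := h k j
  obtain ⟨h1', h2', h3'⟩ := h' k j
  simp only [Prod.snd_sub, Prod.fst_sub, Pi.sub_apply, PiLp.sub_apply]
  refine ⟨fun hj => by rw [h1 hj, h1' hj, sub_zero], fun hj => by rw [h2 hj, h2' hj, sub_zero], ?_⟩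
  by_cases hj : j ∈ I₁ k
  · simp [h1 hj, h1' hj]
  by_cases hj' : j ∈ I₂ k
  · simp [h2 hj', h2' hj']
  obtain ⟨a, b, c⟩ := h3 hj hj'
  obtain ⟨a', b', c'⟩ := h3' hj hj'
  nlinarith [mul_nonneg a (neg_nonneg.2 b'), mul_nonneg a' (neg_nonneg.2 b)]

theorem isClosed_monotoneCone {ι X : Type*} [TopologicalSpace X] {m : ι → ℕ}
    (I₁ I₂ : ∀ k, Set (Fin (m k))) : IsClosed (monotoneCone X I₁ I₂) := by
  simp only [monotoneCone, Set.ofPred_forall, Set.ofPred_and]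
  refine isClosed_iInter fun k => isClosed_iInter fun j => ?_
  refine IsClosed.inter (isClosed_iInter fun _ => isClosed_eq (by fun_prop) (by fun_prop))
    (IsClosed.inter (isClosed_iInter fun _ => isClosed_eq (by fun_prop) (by fun_prop))
      (isClosed_le (by fun_prop) (by fun_prop)))

/-! ### Lipschitz inversion of the linearized complementarity system -/

section LinearInverse

variable {ι : Type*} [Fintype ι] {E : ι → Type*} [∀ k, NormedAddCommGroup (E k)]
  [∀ k, InnerProductSpace ℝ (E k)] [∀ k, FiniteDimensional ℝ (E k)] {m : ι → ℕ}
  (Hop : ∀ k, (∀ i, E i) →L[ℝ] E k) (g : ∀ k, Fin (m k) → E k)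
  (T : ((∀ k, E k) × (∀ k, EuclideanSpace ℝ (Fin (m k))) × (∀ k, EuclideanSpace ℝ (Fin (m k))))
    →L[ℝ] (∀ k, E k) × (∀ k, EuclideanSpace ℝ (Fin (m k))))
  (hT₁ : ∀ q k, (T q).1 k = Hop k q.1 + ∑ j, q.2.1 k j • g k j)
  (hT₂ : ∀ q k j, (T q).2 k j = ⟪g k j, q.1 k⟫_ℝ - q.2.2 k j)
  (I₁ I₂ : ∀ k, Set (Fin (m k)))
  (hindep : ∀ k, ∀ μ : EuclideanSpace ℝ (Fin (m k)), (∀ j ∈ I₂ k, μ j = 0) →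
    ∑ j, μ j • g k j = 0 → μ = 0)
  (hpos : ∀ y : ∀ k, E k, (∀ k, ∀ j ∈ I₁ k, ⟪g k j, y k⟫_ℝ = 0) → y ≠ 0 →
    0 < ∑ k, ⟪y k, Hop k y⟫_ℝ)

include hT₁ hT₂ hindep hpos

/-- The cone is closed, so by compactness it is enough that T has no nonzero kernel vector in it.
Monotonicity and definiteness kill y, the second row then kills η, and linear independence kills μ.
-/
theorem exists_expansion_on_monotoneCone :
    ∃ c : ℝ, 0 < c ∧ ∀ q ∈ monotoneCone (∀ k, E k) I₁ I₂, c * ‖q‖ ≤ ‖T q‖ := by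
  have := exists_pos_mul_norm_pow_le (isClosed_monotoneCone (X := ∀ k, E k) I₁ I₂) ?_
    (φ := fun q => ‖T q‖) (by fun_prop) 1 ?_ one_ne_zero ?_
  · simpa using this
  · intro t ht q hq k j
    obtain ⟨h1, h2, h3⟩ := hq k j
    simp only [Prod.smul_snd, Prod.smul_fst, Pi.smul_apply, PiLp.smul_apply, smul_eq_mul]
    refine ⟨fun hj => by rw [h1 hj, mul_zero], fun hj => by rw [h2 hj, mul_zero], ?_⟩
    calc (0 : ℝ) ≤ t * t * (q.2.1 k j * q.2.2 k j) := by positivity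
      _ = _ := by ring
  · intro t ht q
    simp [norm_smul, abs_of_nonneg ht]
  · intro q hq hq0
    refine norm_pos_iff.2 fun hT => hq0 ?_
    have h1 : ∀ k, Hop k q.1 + ∑ j, q.2.1 k j • g k j = 0 := fun k => by
      rw [← hT₁ q k, hT]; rfl
    have h2 : ∀ k j, ⟪g k j, q.1 k⟫_ℝ = q.2.2 k j := fun k j => by
      rw [← sub_eq_zero, ← hT₂ q k j, hT]; rfl
    have hy : q.1 = 0 := by
      by_contra hne
      refine absurd (hpos q.1 (fun k j hj => by rw [h2, (hq k j).1 hj]) hne) (not_lt.2 ?_)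
      refine Finset.sum_nonpos fun k _ => ?_
      rw [eq_neg_of_add_eq_zero_left (h1 k), inner_neg_right, inner_sum, neg_nonpos]
      refine Finset.sum_nonneg fun j _ => ?_
      rw [inner_smul_right, real_inner_comm, h2]
      exact (hq k j).2.2
    have hη : q.2.2 = 0 := by
      ext k j
      rw [← h2 k j, hy]; simp
    have hμ : q.2.1 = 0 := by
      funext k
      refine hindep k _ (fun j hj => (hq k j).2.1 hj) ?_
      have := h1 k
      rwa [hy, map_zero, zero_add] at this
    exact Prod.ext hy (Prod.ext hμ hη)

/-- The linearized complementarity system has a Lipschitz solution operator. -/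
theorem exists_lipschitz_inverse_on_complementarityCone
    (hdisj : ∀ k, ∀ j ∈ I₁ k, j ∉ I₂ k) :
    ∃ (Ψ : ((∀ k, E k) × (∀ k, EuclideanSpace ℝ (Fin (m k)))) → _) (K : ℝ), 0 < K ∧
      (∀ y y', ‖Ψ y - Ψ y'‖ ≤ K * ‖y - y'‖) ∧ (∀ y, Ψ y ∈ complementarityCone (∀ k, E k) I₁ I₂) ∧
      (∀ y, T (Ψ y) = y) ∧ ∀ q ∈ complementarityCone (∀ k, E k) I₁ I₂, Ψ (T q) = q := by
  classical
  obtain ⟨c, hc, hcT⟩ := exists_expansion_on_monotoneCone Hop g T hT₁ hT₂ I₁ I₂ hindep hpos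
  -- The multiplier part is μ = aζ + t b|ζ| and the slack part η = ζ - μ. At t = 1 this gives μ = ζ
  -- on I₁, μ = 0 on I₂, and elsewhere the positive part of ζ, with η minus the negative part; at t
  -- = 0 it is linear.
  set a : ∀ k, Fin (m k) → ℝ := fun k j => if j ∈ I₁ k then 1 else if j ∈ I₂ k then 0 else 1 / 2
    with ha
  set b : ∀ k, Fin (m k) → ℝ := fun k j => if j ∈ I₁ k then 0 else if j ∈ I₂ k then 0 else 1 / 2
    with hb
  let A : (∀ k, EuclideanSpace ℝ (Fin (m k))) →ₗ[ℝ] (∀ k, EuclideanSpace ℝ (Fin (m k))) :=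
    { toFun := fun ζ k => WithLp.toLp 2 fun j => a k j * ζ k j
      map_add' := fun x y => by ext k j; simp [mul_add]
      map_smul' := fun t x => by ext k j; simp; ring }
  let B : (∀ k, EuclideanSpace ℝ (Fin (m k))) → (∀ k, EuclideanSpace ℝ (Fin (m k))) :=
    fun ζ k => WithLp.toLp 2 fun j => b k j * |ζ k j|
  have hA : ∀ ζ k j, A ζ k j = a k j * ζ k j := fun _ _ _ => rfl
  have hB : ∀ ζ k j, B ζ k j = b k j * |ζ k j| := fun _ _ _ => rfl
  let κ : ℝ → ((∀ k, E k) × (∀ k, EuclideanSpace ℝ (Fin (m k)))) →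
      (∀ k, E k) × (∀ k, EuclideanSpace ℝ (Fin (m k))) ×
      (∀ k, EuclideanSpace ℝ (Fin (m k))) :=
    fun t z => (z.1, A z.2 + t • B z.2, z.2 - A z.2 - t • B z.2)
  have hκ : ∀ t ∈ Set.Icc (0 : ℝ) 1, ∀ z z', κ t z - κ t z' ∈ monotoneCone (∀ k, E k) I₁ I₂ := by
    intro t ht z z' k j
    simp only [κ, Prod.mk_sub_mk, Pi.sub_apply, Pi.add_apply, Pi.smul_apply, PiLp.sub_apply,
      PiLp.add_apply, PiLp.smul_apply, hA, hB, smul_eq_mul]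
    by_cases h1 : j ∈ I₁ k
    · have ea : a k j = 1 := by simp [ha, h1]
      have eb : b k j = 0 := by simp [hb, h1]
      rw [ea, eb]
      refine ⟨fun _ => by ring, fun h2 => absurd h2 (hdisj k j h1), le_of_eq (by ring)⟩
    by_cases h2 : j ∈ I₂ k
    · have ea : a k j = 0 := by simp [ha, h1, h2]
      have eb : b k j = 0 := by simp [hb, h1, h2]
      rw [ea, eb]
      exact ⟨fun h => absurd h h1, fun h2 => by ring, le_of_eq (by ring)⟩
    · have ea : a k j = 1 / 2 := by simp [ha, h1, h2]
      have eb : b k j = 1 / 2 := by simp [hb, h1, h2]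
      rw [ea, eb]
      refine ⟨fun h => absurd h h1, fun h => absurd h h2, ?_⟩
      -- The product of the two differences is (Δζ² - t² (Δ|ζ|)²)/4, nonnegative for t ≤ 1 since the
      -- absolute value is 1-Lipschitz.
      have h3 : (|z.2 k j| - |z'.2 k j|) ^ 2 ≤ (z.2 k j - z'.2 k j) ^ 2 :=
        sq_le_sq.2 (abs_abs_sub_abs_le _ _)
      have h4 : t ^ 2 * (|z.2 k j| - |z'.2 k j|) ^ 2 ≤ 1 * (z.2 k j - z'.2 k j) ^ 2 :=
        mul_le_mul (pow_le_one₀ ht.1 ht.2) h3 (sq_nonneg _) zero_le_one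
      nlinarith
  have hexp : ∀ t ∈ Set.Icc (0 : ℝ) 1, ∀ z z',
      c / 2 * ‖z - z'‖ ≤ ‖T (κ t z) - T (κ t z')‖ := by
    intro t ht z z'
    rw [← map_sub]
    refine le_trans ?_ (hcT _ (hκ t ht z z'))
    -- The parameter is recovered as ζ = μ + η; the sum costs the factor 2.
    have h1 : ‖z - z'‖ ≤ 2 * ‖κ t z - κ t z'‖ := by
      set q := κ t z - κ t z' with hq
      have : z - z' = (q.1, q.2.1 + q.2.2) := by
        simp only [hq, κ, Prod.mk_sub_mk]
        refine Prod.ext rfl ?_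
        simp only
        rw [Prod.snd_sub]
        abel
      rw [this, Prod.norm_mk, two_mul]
      have e1 : ‖q.2‖ ≤ ‖q‖ := norm_snd_le q
      have e2 := norm_fst_le q
      have e3 := norm_fst_le q.2
      have e4 := norm_snd_le q.2
      refine max_le (by linarith [norm_nonneg q]) ((norm_add_le _ _).trans (by linarith))
    calc c / 2 * ‖z - z'‖ ≤ c / 2 * (2 * ‖κ t z - κ t z'‖) := by gcongr
      _ = _ := by ring
  let Φ : ((∀ k, E k) × (∀ k, EuclideanSpace ℝ (Fin (m k)))) →ₗ[ℝ]
      ((∀ k, E k) × (∀ k, EuclideanSpace ℝ (Fin (m k)))) := T.toLinearMap ∘ₗ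
    (LinearMap.fst ℝ _ _).prod ((A ∘ₗ LinearMap.snd ℝ _ _).prod
      (LinearMap.snd ℝ _ _ - A ∘ₗ LinearMap.snd ℝ _ _))
  let β : ((∀ k, E k) × (∀ k, EuclideanSpace ℝ (Fin (m k)))) →
      ((∀ k, E k) × (∀ k, EuclideanSpace ℝ (Fin (m k)))) := fun z => T (0, B z.2, -B z.2)
  have hΦβ : ∀ t z, Φ z + t • β z = T (κ t z) := by
    intro t z
    simp only [Φ, β, κ, LinearMap.comp_apply, ContinuousLinearMap.coe_coe, ← map_smul, ← map_add]
    congr 1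
    refine Prod.ext ?_ (Prod.ext ?_ ?_) <;> simp [sub_eq_add_neg]
  have hsurj : Function.Surjective fun z => Φ z + β z := by
    refine surjective_of_homotopy_expanding (K := ‖T‖) (half_pos hc) T.opNorm_nonneg ?_ ?_ ?_
    -- At t = 0 the map is a linear endomorphism of a finite-dimensional space, so the expansion
    -- estimate already yields surjectivity.
    · refine LinearMap.injective_iff_surjective.1 fun z z' h => ?_
      have := hexp 0 (by simp) z z'
      rw [← hΦβ, ← hΦβ, h, zero_smul, zero_smul, sub_self, norm_zero] at this
      have h0 : ‖z - z'‖ ≤ 0 := by nlinarith [norm_nonneg (z - z')]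
      exact sub_eq_zero.1 (norm_le_zero_iff.1 h0)
    · intro t ht z z'
      rw [hΦβ, hΦβ]
      exact hexp t ht z z'
    · intro z z'
      simp only [β]
      rw [← map_sub]
      refine (T.le_opNorm _).trans ?_
      gcongr
      have hBz : ‖B z.2 - B z'.2‖ ≤ ‖z.2 - z'.2‖ := by
        refine norm_pi_euclideanSpace_le fun k j => ?_
        simp only [Pi.sub_apply, PiLp.sub_apply, hB]
        have hb0 : |b k j| ≤ 1 := by
          simp only [hb]; split_ifs <;> norm_num [abs_of_pos]
        rw [← mul_sub, abs_mul]
        calc _ ≤ 1 * |z.2 k j - z'.2 k j| := by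
              exact mul_le_mul hb0 (abs_abs_sub_abs_le _ _) (abs_nonneg _) zero_le_one
          _ = _ := one_mul _
      rw [Prod.mk_sub_mk, Prod.mk_sub_mk, Prod.norm_mk, Prod.norm_mk, sub_self, norm_zero]
      have : ‖-B z.2 - -B z'.2‖ = ‖B z.2 - B z'.2‖ := by rw [← norm_neg]; congr 1; abel
      rw [this, max_self, max_eq_right (norm_nonneg _)]
      exact hBz.trans (norm_snd_le (z - z'))
  have hsurj' : Function.Surjective fun z => T (κ 1 z) := by
    convert hsurj using 2 with z
    rw [← hΦβ, one_smul]
  choose Ξ hΞ using hsurj'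
  replace hΞ : ∀ y, T (κ 1 (Ξ y)) = y := hΞ
  have hκC : ∀ z, κ 1 z ∈ complementarityCone (∀ k, E k) I₁ I₂ := by
    intro z k j
    have e1 : (κ 1 z).2.1 k j = a k j * z.2 k j + b k j * |z.2 k j| := by
      simp [κ, hA, hB]
    have e2 : (κ 1 z).2.2 k j = z.2 k j - a k j * z.2 k j - b k j * |z.2 k j| := by
      simp [κ, hA, hB]
    rw [e1, e2]
    by_cases h1 : j ∈ I₁ k
    · have ea : a k j = 1 := by simp [ha, h1]
      have eb : b k j = 0 := by simp [hb, h1]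
      rw [ea, eb]
      exact ⟨fun _ => by ring, fun h2 => absurd h2 (hdisj k j h1), fun h => absurd h1 h⟩
    by_cases h2 : j ∈ I₂ k
    · have ea : a k j = 0 := by simp [ha, h1, h2]
      have eb : b k j = 0 := by simp [hb, h1, h2]
      rw [ea, eb]
      exact ⟨fun h => absurd h h1, fun h2 => by ring, fun _ h => absurd h2 h⟩
    · have ea : a k j = 1 / 2 := by simp [ha, h1, h2]
      have eb : b k j = 1 / 2 := by simp [hb, h1, h2]
      rw [ea, eb]
      refine ⟨fun h => absurd h h1, fun h => absurd h h2, fun _ _ => ⟨?_, ?_, ?_⟩⟩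
      · linarith [neg_abs_le (z.2 k j)]
      · linarith [le_abs_self (z.2 k j)]
      · linear_combination (-1 / 4 : ℝ) * sq_abs (z.2 k j)
  refine ⟨fun y => κ 1 (Ξ y), c⁻¹, inv_pos.2 hc, fun y y' => ?_, fun y => hκC _, hΞ, fun q hq => ?_⟩
  · have := hcT _ (sub_mem_monotoneCone (hκC (Ξ y)) (hκC (Ξ y')))
    rw [map_sub, hΞ, hΞ] at this
    rwa [le_inv_mul_iff₀ hc]
  · have := hcT _ (sub_mem_monotoneCone (hκC (Ξ (T q))) hq)
    rw [map_sub, hΞ, sub_self, norm_zero] at this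
    have h0 : ‖κ 1 (Ξ (T q)) - q‖ ≤ 0 := by
      nlinarith [norm_nonneg (κ 1 (Ξ (T q)) - q)]
    exact sub_eq_zero.1 (norm_le_zero_iff.1 h0)

end LinearInverse

/-! ### Smoothness and derivatives of the Lagrangian gradients -/

noncomputable section

theorem gradient_apply {n : ℕ} (φ : EuclideanSpace ℝ (Fin n) → ℝ) (x : EuclideanSpace ℝ (Fin n))
    (a : Fin n) : (∇ φ x) a = fderiv ℝ φ x (EuclideanSpace.single a 1) := by
  have h : ⟪∇ φ x, EuclideanSpace.single a (1 : ℝ)⟫_ℝ = fderiv ℝ φ x (EuclideanSpace.single a 1) := by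
    rw [gradient, InnerProductSpace.toDual_symm_apply]
  rw [← h, EuclideanSpace.inner_single_right]
  simp

theorem sum_smul_euclidean_single {n : ℕ} (y : EuclideanSpace ℝ (Fin n)) :
    ∑ b, y b • EuclideanSpace.single b (1 : ℝ) = y := by
  ext a
  simp [Pi.single_apply]

namespace NEP

variable {G : NEP}

/-- The gradient `∇_{x^k} f^k`. -/
def gradf (k : Fin G.N) (x : G.Strategy) (w : EuclideanSpace ℝ (Fin (G.d k))) :
    EuclideanSpace ℝ (Fin (G.n k)) :=
  ∇ (fun y => G.f k (Function.update x k y) w) (x k)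

/-- The gradient `∇_{x^k} g^k_i`. -/
def gradgAt (k : Fin G.N) (i : Fin (G.m k)) (y : EuclideanSpace ℝ (Fin (G.n k)))
    (w : EuclideanSpace ℝ (Fin (G.d k))) : EuclideanSpace ℝ (Fin (G.n k)) :=
  ∇ (fun y => G.g k i y w) y

theorem contDiff_coord {E : Fin G.N → Type*} [∀ j, NormedAddCommGroup (E j)]
    [∀ j, NormedSpace ℝ (E j)] {n : WithTop ℕ∞} (k : Fin G.N) :
    ContDiff ℝ n (fun x : ∀ j, E j => x k) :=
  contDiff_pi.1 contDiff_id k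

theorem contDiff_update (k : Fin G.N) :
    ContDiff ℝ 2 (fun z : G.Strategy × EuclideanSpace ℝ (Fin (G.n k)) =>
      Function.update z.1 k z.2) := by
  rw [contDiff_pi]
  intro j
  by_cases h : j = k
  · subst h
    simpa using contDiff_snd
  · simp only [Function.update_of_ne h]
    exact (contDiff_coord j).comp contDiff_fst

theorem hasFDerivAt_f (k : Fin G.N) (x : G.Strategy) (w : EuclideanSpace ℝ (Fin (G.d k)))
    (y : EuclideanSpace ℝ (Fin (G.n k))) :
    HasFDerivAt (fun y => G.f k (Function.update x k y) w)
      ((fderiv ℝ (fun z : G.Strategy × EuclideanSpace ℝ (Fin (G.d k)) => G.f k z.1 z.2)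
        (Function.update x k y, w)).comp
        ((ContinuousLinearMap.inl ℝ _ _).comp
          (.pi (Pi.single k (.id ℝ (EuclideanSpace ℝ (Fin (G.n k)))))))) y := by
  have h1 := (((G.f_contDiff k).differentiable (by norm_num)) (Function.update x k y, w)).hasFDerivAt
  have h2 : HasFDerivAt (fun z : EuclideanSpace ℝ (Fin (G.n k)) => (Function.update x k z, w)) _ y :=
    ((ContinuousLinearMap.inl ℝ G.Strategy (EuclideanSpace ℝ (Fin (G.d k)))).hasFDerivAt.comp y
      (hasFDerivAt_update (𝕜 := ℝ) (E := fun j => EuclideanSpace ℝ (Fin (G.n j))) x y)).add_const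
        (0, w) |>.congr_of_eventuallyEq
      (Eventually.of_forall fun z => by simp)
  exact h1.comp y h2

theorem hasFDerivAt_g (k : Fin G.N) (i : Fin (G.m k)) (w : EuclideanSpace ℝ (Fin (G.d k)))
    (y : EuclideanSpace ℝ (Fin (G.n k))) :
    HasFDerivAt (fun y => G.g k i y w)
      ((fderiv ℝ (fun z : EuclideanSpace ℝ (Fin (G.n k)) × EuclideanSpace ℝ (Fin (G.d k)) =>
        G.g k i z.1 z.2) (y, w)).comp (ContinuousLinearMap.inl ℝ _ _)) y :=
  (((G.g_contDiff k i).differentiable (by norm_num)) (y, w)).hasFDerivAt.comp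
    (f := fun y => (y, w)) y (hasFDerivAt_prodMk_left y w)

theorem contDiff_gradf (k : Fin G.N) :
    ContDiff ℝ 1 (fun z : G.Strategy × EuclideanSpace ℝ (Fin (G.d k)) => gradf k z.1 z.2) := by
  rw [contDiff_euclidean]
  intro a
  simp only [gradf, gradient_apply, (hasFDerivAt_f _ _ _ _).fderiv, Function.update_eq_self]
  exact ((G.f_contDiff k).fderiv_right (m := 1) (by norm_num)).clm_apply contDiff_const

theorem contDiff_gradgAt (k : Fin G.N) (i : Fin (G.m k)) :
    ContDiff ℝ 1 (fun z : EuclideanSpace ℝ (Fin (G.n k)) × EuclideanSpace ℝ (Fin (G.d k)) =>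
      gradgAt k i z.1 z.2) := by
  rw [contDiff_euclidean]
  intro a
  simp only [gradgAt, gradient_apply, (hasFDerivAt_g _ _ _ _).fderiv]
  exact ((G.g_contDiff k i).fderiv_right (m := 1) (by norm_num)).clm_apply contDiff_const

/-- Separates the affine dependence on the multipliers, which gives the C¹ regularity and the
multiplier columns of the linearization. -/
theorem gradL_eq (k : Fin G.N) (x : G.Strategy) (l : EuclideanSpace ℝ (Fin (G.m k)))
    (w : EuclideanSpace ℝ (Fin (G.d k))) :
    gradL k x l w = gradf k x w + ∑ i, l i • gradgAt k i (x k) w := by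
  have h := (hasFDerivAt_f k x w (x k)).add
    (HasFDerivAt.fun_sum (u := Finset.univ) fun i _ => (hasFDerivAt_g k i w (x k)).const_mul (l i))
  have e : (fun y => lagrangian k (Function.update x k y) l w) =
      (fun y => G.f k (Function.update x k y) w) + fun y => ∑ i, l i * G.g k i y w := by
    funext y
    simp [lagrangian]
  have h' := h.fderiv
  rw [← e] at h'
  ext a
  simp only [gradL, gradient_apply, h', gradf, gradgAt, PiLp.add_apply,
    WithLp.ofLp_sum, Finset.sum_apply, PiLp.smul_apply, (hasFDerivAt_f _ _ _ _).fderiv,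
    (hasFDerivAt_g _ _ _ _).fderiv, _root_.add_apply, _root_.sum_apply,
    _root_.smul_apply]

theorem contDiff_gradL (k : Fin G.N) :
    ContDiff ℝ 1 (fun z : G.Strategy × EuclideanSpace ℝ (Fin (G.m k)) ×
      EuclideanSpace ℝ (Fin (G.d k)) => gradL k z.1 z.2.1 z.2.2) := by
  simp only [gradL_eq]
  refine ((contDiff_gradf k).comp (contDiff_fst.prodMk contDiff_snd.snd)).add
    (ContDiff.sum fun i _ => ContDiff.smul
      ((contDiff_euclidean.1 contDiff_id i).comp (contDiff_fst.comp contDiff_snd))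
      ((contDiff_gradgAt k i).comp (f := fun z : G.Strategy × EuclideanSpace ℝ (Fin (G.m k)) × EuclideanSpace ℝ (Fin (G.d k)) =>
        (z.1 k, z.2.2)) (((contDiff_coord k).comp contDiff_fst).prodMk contDiff_snd.snd)))

/-- The derivative of `∇_{x^k} L^k` with respect to the whole strategy profile. -/
def hessOp (k : Fin G.N) (x : G.Strategy) (l : EuclideanSpace ℝ (Fin (G.m k)))
    (w : EuclideanSpace ℝ (Fin (G.d k))) : G.Strategy →L[ℝ] EuclideanSpace ℝ (Fin (G.n k)) :=
  fderiv ℝ (fun x => gradL k x l w) x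

theorem hasFDerivAt_gradL (k : Fin G.N) (x : G.Strategy) (l : EuclideanSpace ℝ (Fin (G.m k)))
    (w : EuclideanSpace ℝ (Fin (G.d k))) :
    HasFDerivAt (fun x => gradL k x l w) (hessOp k x l w) x := by
  have : ContDiff ℝ 1 (fun x => gradL k x l w) :=
    (contDiff_gradL k).comp (f := fun x => (x, l, w)) (by fun_prop)
  exact (this.differentiable (by norm_num) x).hasFDerivAt

theorem hasFDerivAt_gradL_update (k i : Fin G.N) (x : G.Strategy)
    (l : EuclideanSpace ℝ (Fin (G.m k))) (w : EuclideanSpace ℝ (Fin (G.d k))) :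
    HasFDerivAt (fun z => gradL k (Function.update x i z) l w)
      ((hessOp k x l w).comp (.pi (Pi.single i (.id ℝ (EuclideanSpace ℝ (Fin (G.n i))))))) (x i) := by
  refine HasFDerivAt.comp (g := fun x => gradL k x l w) (f := Function.update x i) (x i) ?_
    (hasFDerivAt_update (𝕜 := ℝ) (E := fun j => EuclideanSpace ℝ (Fin (G.n j))) x (x i))
  rw [Function.update_eq_self]
  exact hasFDerivAt_gradL k x l w

theorem pi_single_id_apply (i : Fin G.N) (h : EuclideanSpace ℝ (Fin (G.n i))) :
    (ContinuousLinearMap.pi (Pi.single i (.id ℝ (EuclideanSpace ℝ (Fin (G.n i))))) :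
      EuclideanSpace ℝ (Fin (G.n i)) →L[ℝ] G.Strategy) h = Pi.single i h := by
  funext j
  by_cases hj : j = i
  · subst hj; simp
  · simp [Pi.single_eq_of_ne hj]

theorem hessL_apply (k i : Fin G.N) (x : G.Strategy)
    (l : EuclideanSpace ℝ (Fin (G.m k))) (w : EuclideanSpace ℝ (Fin (G.d k))) (a b) :
    hessL k i x l w a b = hessOp k x l w (Pi.single i (EuclideanSpace.single b 1)) a := by
  rw [hessL, Matrix.of_apply, (hasFDerivAt_gradL_update k i x l w).fderiv,
    ContinuousLinearMap.comp_apply, pi_single_id_apply]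

theorem hessL_mulVec (k i : Fin G.N) (x : G.Strategy)
    (l : EuclideanSpace ℝ (Fin (G.m k))) (w : EuclideanSpace ℝ (Fin (G.d k)))
    (h : EuclideanSpace ℝ (Fin (G.n i))) :
    hessL k i x l w *ᵥ h.ofLp = (hessOp k x l w (Pi.single i h)).ofLp := by
  have e : (Pi.single i h : G.Strategy) =
      ∑ b, h b • (Pi.single i (EuclideanSpace.single b (1 : ℝ)) : G.Strategy) := by
    conv_lhs => rw [← sum_smul_euclidean_single h]
    simp_rw [← Pi.single_smul]
    exact map_sum (LinearMap.single ℝ (fun j => EuclideanSpace ℝ (Fin (G.n j))) i) _ _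
  ext a
  rw [e, map_sum]
  simp [Matrix.mulVec, dotProduct, hessL_apply, mul_comm]

theorem inner_hessOp (k : Fin G.N) (x : G.Strategy)
    (l : EuclideanSpace ℝ (Fin (G.m k))) (w : EuclideanSpace ℝ (Fin (G.d k)))
    (v : EuclideanSpace ℝ (Fin (G.n k))) (y : G.Strategy) :
    ⟪v, hessOp k x l w y⟫_ℝ = ∑ i, v.ofLp ⬝ᵥ (hessL k i x l w *ᵥ (y i).ofLp) := by
  conv_lhs => rw [← Finset.univ_sum_single y, map_sum, inner_sum]
  refine Finset.sum_congr rfl fun i _ => ?_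
  rw [hessL_mulVec, EuclideanSpace.inner_eq_star_dotProduct, dotProduct_comm]
  simp

theorem contDiff_lagrangian_update (k : Fin G.N) (x : G.Strategy)
    (l : EuclideanSpace ℝ (Fin (G.m k))) (w : EuclideanSpace ℝ (Fin (G.d k))) :
    ContDiff ℝ 2 (fun y => lagrangian k (Function.update x k y) l w) := by
  simp only [lagrangian, Function.update_self]
  exact ((G.f_contDiff k).comp (((contDiff_update k).comp
    (contDiff_const.prodMk contDiff_id)).prodMk contDiff_const)).add
    (ContDiff.sum fun i _ => contDiff_const.mul ((G.g_contDiff k i).comp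
      (contDiff_id.prodMk contDiff_const)))

/-- Schwarz's theorem for a single player's Lagrangian. Only the diagonal blocks are Hessians of one
function; their symmetry is what completing the square needs. -/
theorem hessL_self_transpose (k : Fin G.N) (x : G.Strategy)
    (l : EuclideanSpace ℝ (Fin (G.m k))) (w : EuclideanSpace ℝ (Fin (G.d k))) :
    (hessL k k x l w)ᵀ = hessL k k x l w := by
  set φ : EuclideanSpace ℝ (Fin (G.n k)) → ℝ := fun y => lagrangian k (Function.update x k y) l w
    with hφ
  have hC : ContDiff ℝ 2 φ := contDiff_lagrangian_update k x l w
  have hgrad : ∀ z, gradL k (Function.update x k z) l w = ∇ φ z := by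
    intro z
    simp [gradL, hφ]
  have hd : DifferentiableAt ℝ (fderiv ℝ φ) (x k) :=
    (hC.fderiv_right (m := 1) (by norm_num)).differentiable (by norm_num) _
  have hd' : DifferentiableAt ℝ (fun z => gradL k (Function.update x k z) l w) (x k) :=
    (hasFDerivAt_gradL_update k k x l w).differentiableAt
  have hent : ∀ a b, hessL k k x l w a b =
      fderiv ℝ (fderiv ℝ φ) (x k) (EuclideanSpace.single b 1) (EuclideanSpace.single a 1) := by
    intro a b
    have h1 := ((PiLp.proj 2 (𝕜 := ℝ) (fun _ : Fin (G.n k) => ℝ) a).hasFDerivAt.comp (x k)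
      hd'.hasFDerivAt)
    have h2 := hd.hasFDerivAt.clm_apply
      (hasFDerivAt_const (EuclideanSpace.single a (1 : ℝ)) (x k))
    have h3 := h1.unique (h2.congr_of_eventuallyEq (Eventually.of_forall fun z => by
      simp [hgrad, gradient_apply]))
    have h4 := DFunLike.congr_fun h3 (EuclideanSpace.single b 1)
    simpa [hessL] using h4
  ext a b
  rw [Matrix.transpose_apply, hent, hent]
  exact (hC.contDiffAt.isSymmSndFDerivAt (by simp)).eq _ _

end NEP

end

/-! ### Quadratic forms, penalization and minimizers from monotone gradients -/

noncomputable section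

/-- A definite quadratic form plus a linear term is bounded below by its minimum value. -/
theorem complete_square_nonneg {r : ℕ} {S : Matrix (Fin r) (Fin r) ℝ} (hsymm : Sᵀ = S)
    (hS : ∀ z, z ≠ 0 → 0 < z ⬝ᵥ (S *ᵥ z)) {a : ℝ} (ha : 0 < a) (z c : Fin r → ℝ) :
    0 ≤ a * (z ⬝ᵥ (S *ᵥ z)) + z ⬝ᵥ c + 1 / (4 * a) * (c ⬝ᵥ (S⁻¹ *ᵥ c)) := by
  have hunit : IsUnit S := by
    rw [← Matrix.mulVec_injective_iff_isUnit]
    intro u v huv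
    by_contra hne
    have := hS (u - v) (sub_ne_zero.2 hne)
    rw [Matrix.mulVec_sub, huv, sub_self, dotProduct_zero] at this
    exact lt_irrefl _ this
  have hdet : IsUnit S.det := (Matrix.isUnit_iff_isUnit_det S).1 hunit
  -- The minimizer is `-w`, and the right-hand side equals a (z + w)ᵀ S (z + w).
  set w := (2 * a)⁻¹ • (S⁻¹ *ᵥ c) with hw
  have hSw : S *ᵥ w = (2 * a)⁻¹ • c := by
    rw [hw, Matrix.mulVec_smul, Matrix.mulVec_mulVec, Matrix.mul_nonsing_inv S hdet,
      Matrix.one_mulVec]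
  have hnonneg : 0 ≤ (z + w) ⬝ᵥ (S *ᵥ (z + w)) := by
    rcases eq_or_ne (z + w) 0 with h | h
    · simp [h]
    · exact (hS _ h).le
  have hcross : w ⬝ᵥ (S *ᵥ z) = (2 * a)⁻¹ * (z ⬝ᵥ c) := by
    rw [Matrix.dotProduct_mulVec, ← Matrix.mulVec_transpose, hsymm, hSw, smul_dotProduct,
      dotProduct_comm, smul_eq_mul]
  have hww : w ⬝ᵥ ((2 * a)⁻¹ • c) = (2 * a)⁻¹ * ((2 * a)⁻¹ * (c ⬝ᵥ (S⁻¹ *ᵥ c))) := by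
    rw [hw, dotProduct_smul, smul_dotProduct, dotProduct_comm]; rfl
  rw [Matrix.mulVec_add, hSw, dotProduct_add, add_dotProduct, add_dotProduct, hcross, hww,
    dotProduct_smul, smul_eq_mul] at hnonneg
  calc (0 : ℝ) ≤ a * _ := mul_nonneg ha.le hnonneg
    _ = _ := by field_simp; ring

/-- A quadratic form that is positive on the common kernel of finitely many functionals becomes
positive definite after adding a multiple of the sum of their squares. -/
theorem exists_augmented_pos {E J : Type*} [NormedAddCommGroup E] [InnerProductSpace ℝ E]
    [FiniteDimensional ℝ E] (L : E →L[ℝ] E) (g : J → E) (I : Finset J)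
    (h : ∀ y, (∀ j ∈ I, ⟪g j, y⟫_ℝ = 0) → y ≠ 0 → 0 < ⟪y, L y⟫_ℝ) :
    ∃ ρ : ℝ, 0 < ρ ∧ ∃ c : ℝ, 0 < c ∧
      ∀ y, c * ‖y‖ ^ 2 ≤ ⟪y, L y⟫_ℝ + ρ * ∑ j ∈ I, ⟪g j, y⟫_ℝ ^ 2 := by
  have hsum : ∀ (t : ℝ) (y : E), ∑ j ∈ I, ⟪g j, t • y⟫_ℝ ^ 2 = t ^ 2 * ∑ j ∈ I, ⟪g j, y⟫_ℝ ^ 2 := by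
    intro t y
    rw [Finset.mul_sum]
    exact Finset.sum_congr rfl fun j _ => by rw [inner_smul_right]; ring
  have hquad : ∀ (t : ℝ) (y : E), ⟪t • y, L (t • y)⟫_ℝ = t ^ 2 * ⟪y, L y⟫_ℝ := by
    intro t y
    rw [map_smul, inner_smul_right, real_inner_smul_left]; ring
  -- On the cone where the form is nonpositive the functionals have no common zero except 0, so
  -- their squares dominate δ‖y‖².
  obtain ⟨δ, hδ, hδC⟩ := exists_pos_mul_norm_pow_le (C := {y : E | ⟪y, L y⟫_ℝ ≤ 0})
    (isClosed_le (by fun_prop) continuous_const)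
    (fun t ht x hx => by
      simp only [Set.mem_ofPred_eq, hquad] at hx ⊢
      exact mul_nonpos_of_nonneg_of_nonpos (sq_nonneg t) hx)
    (φ := fun y => ∑ j ∈ I, ⟪g j, y⟫_ℝ ^ 2) (by fun_prop) 2 (fun t _ y => hsum t y) two_ne_zero
    (fun y hy hy0 => by
      by_contra hcon
      have h0 : ∑ j ∈ I, ⟪g j, y⟫_ℝ ^ 2 = 0 :=
        le_antisymm (not_lt.1 hcon) (Finset.sum_nonneg fun _ _ => sq_nonneg _)
      rw [Finset.sum_eq_zero_iff_of_nonneg fun _ _ => sq_nonneg _] at h0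
      exact absurd (h y (fun j hj => pow_eq_zero_iff two_ne_zero |>.1 (h0 j hj)) hy0)
        (not_lt.2 hy))
  -- With this ρ the penalty is at least (‖L‖ + 1)‖y‖² on that cone and outweighs the worst value
  -- -‖L‖‖y‖² of the form.
  refine ⟨(‖L‖ + 1) / δ, by positivity, ?_⟩
  obtain ⟨c, hc, hcC⟩ := exists_pos_mul_norm_pow_le (C := (Set.univ : Set E)) isClosed_univ
    (fun _ _ _ _ => Set.mem_univ _)
    (φ := fun y => ⟪y, L y⟫_ℝ + (‖L‖ + 1) / δ * ∑ j ∈ I, ⟪g j, y⟫_ℝ ^ 2) (by fun_prop) 2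
    (fun t _ y => by simp only [hsum, hquad]; ring) two_ne_zero
    (fun y _ hy0 => by
      have hy : 0 < ‖y‖ ^ 2 := by positivity
      by_cases hyC : ⟪y, L y⟫_ℝ ≤ 0
      · have h1 := hδC y hyC
        have h2 : -(‖L‖ * ‖y‖ ^ 2) ≤ ⟪y, L y⟫_ℝ := by
          have := (abs_real_inner_le_norm y (L y)).trans
            (mul_le_mul_of_nonneg_left (L.le_opNorm y) (norm_nonneg y))
          have := (abs_le.1 this).1
          linarith [this, sq ‖y‖, mul_comm ‖y‖ (‖L‖ * ‖y‖), mul_assoc ‖L‖ ‖y‖ ‖y‖,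
            congrArg (‖L‖ * ·) (sq ‖y‖)]
        have h3 : (‖L‖ + 1) * ‖y‖ ^ 2 ≤ (‖L‖ + 1) / δ * ∑ j ∈ I, ⟪g j, y⟫_ℝ ^ 2 := by
          calc (‖L‖ + 1) * ‖y‖ ^ 2 = (‖L‖ + 1) / δ * (δ * ‖y‖ ^ 2) := by field_simp
            _ ≤ _ := by gcongr
        linarith
      · have : 0 ≤ (‖L‖ + 1) / δ * ∑ j ∈ I, ⟪g j, y⟫_ℝ ^ 2 :=
          mul_nonneg (by positivity) (Finset.sum_nonneg fun _ _ => sq_nonneg _)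
        linarith [not_le.1 hyC])
  exact ⟨c, hc, fun y => hcC y trivial⟩

/-- If a parametrized gradient field has a positive definite partial derivative at a point, its
zeros nearby are minimizers on a fixed ball. -/
theorem exists_ball_forall_le_of_gradient {E Θ : Type*} [NormedAddCommGroup E]
    [InnerProductSpace ℝ E] [CompleteSpace E] [NormedAddCommGroup Θ] [NormedSpace ℝ Θ]
    {Γ : E × Θ → E} {D : E × Θ →L[ℝ] E} {y₀ : E} {θ₀ : Θ}
    (hΓ : HasStrictFDerivAt Γ D (y₀, θ₀)) {c : ℝ} (hc : 0 < c)
    (hD : ∀ h, c * ‖h‖ ^ 2 ≤ ⟪h, D (h, 0)⟫_ℝ) :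
    ∃ r : ℝ, 0 < r ∧ ∀ᶠ θ in 𝓝 θ₀, ∀ A : E → ℝ,
      (∀ y, HasGradientAt A (Γ (y, θ)) y) → ∀ x ∈ Metric.ball y₀ r, Γ (x, θ) = 0 →
        ∀ y ∈ Metric.ball y₀ r, A x ≤ A y := by
  -- The error constant is the coercivity constant c itself: the two cancel to 0 ≤ ⟨Γ(z, θ), z - x⟩,
  -- which is all that is needed.
  have happ := hΓ.isLittleO.def hc
  rw [nhds_prod_eq, Filter.eventually_prod_iff] at happ
  obtain ⟨P, hP, P', hP', hPP'⟩ := happ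
  obtain ⟨r, hr, hrP⟩ := Metric.eventually_nhds_iff_ball.1 (hP.and hP')
  refine ⟨r, hr, ?_⟩
  filter_upwards [Metric.ball_mem_nhds θ₀ hr] with θ hθ A hA x hx hx0 y hy
  have hm : ∀ a ∈ Metric.ball y₀ r, (a, θ) ∈ Metric.ball (y₀, θ₀) r := by
    intro a ha
    rw [Metric.mem_ball, Prod.dist_eq]
    exact max_lt ha hθ
  have hmono : ∀ z ∈ Metric.ball y₀ r, 0 ≤ ⟪Γ (z, θ), z - x⟫_ℝ := by
    intro z hz
    have h := hPP' (hrP _ (hm z hz)).1 (hrP _ (hm x hx)).2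
    simp only [hx0, sub_zero, Prod.mk_sub_mk, sub_self] at h
    have hn : ‖((z - x, 0) : E × Θ)‖ = ‖z - x‖ := by simp [Prod.norm_mk]
    rw [hn] at h
    have h1 := (abs_le.1 ((abs_real_inner_le_norm (z - x) (Γ (z, θ) - D (z - x, 0))).trans
      (mul_le_mul_of_nonneg_left h (norm_nonneg _)))).1
    rw [inner_sub_right] at h1
    rw [real_inner_comm]
    nlinarith [hD (z - x)]
  obtain ⟨z, hz, hzA⟩ := domain_mvt (f := A) (s := Metric.ball y₀ r)
    (f' := fun y => InnerProductSpace.toDual ℝ E (Γ (y, θ)))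
    (fun y _ => (hA y).hasFDerivAt.hasFDerivWithinAt) (convex_ball y₀ r) hx hy
  have hzball := (convex_ball y₀ r).segment_subset hx hy hz
  rw [InnerProductSpace.toDual_apply_apply] at hzA
  obtain ⟨t, ht, rfl⟩ := (segment_eq_image' ℝ x y ▸ hz : z ∈ (fun t : ℝ => x + t • (y - x)) '' _)
  have h2 := hmono _ hzball
  simp only [add_sub_cancel_left, inner_smul_right] at h2
  rw [← sub_nonneg, hzA]
  -- The mean value point is x + t(y - x). For t > 0 divide the monotonicity inequality by t; for t
  -- = 0 the gradient vanishes.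
  rcases ht.1.eq_or_lt with h0 | h0
  · simp [← h0, hx0]
  · exact nonneg_of_mul_nonneg_right h2 h0

/-! ### Positive definiteness of the game Jacobian -/

namespace NEP

variable {G : NEP}

theorem basisMatrix_mulVec_repr {n r : ℕ} {S : Submodule ℝ (EuclideanSpace ℝ (Fin n))}
    (b : Module.Basis (Fin r) ℝ S) (z : Fin r → ℝ) :
    basisMatrix b *ᵥ z = ((∑ c, z c • b c : S) : EuclideanSpace ℝ (Fin n)).ofLp := by
  ext a
  simp [basisMatrix, Matrix.mulVec, dotProduct, mul_comm]

/-- The contribution of a pair of players to the quadratic form of the game. -/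
theorem pair_form_nonneg (p : G.Param) (x : G.Strategy) (l : G.Multiplier) {i k : Fin G.N}
    (hi : SSOSC p x l i) {r : ℕ} (b : Module.Basis (Fin r) ℝ (M p x l i))
    {α : Fin G.N → Fin G.N → ℝ} (hik : 0 < α i k) (hki : 0 < α k i)
    {yi : EuclideanSpace ℝ (Fin (G.n i))} (hyi : yi ∈ M p x l i)
    (yk : EuclideanSpace ℝ (Fin (G.n k))) :
    α k i * (yk.ofLp ⬝ᵥ (schur p x l α i k (basisMatrix b) *ᵥ yk.ofLp)) ≤
      α i k * (yi.ofLp ⬝ᵥ (H p x l i i *ᵥ yi.ofLp)) +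
      α k i * (yk.ofLp ⬝ᵥ (H p x l k k *ᵥ yk.ofLp)) +
      (yi.ofLp ⬝ᵥ (H p x l i k *ᵥ yk.ofLp) + yk.ofLp ⬝ᵥ (H p x l k i *ᵥ yi.ofLp)) := by
  set B := basisMatrix b with hB
  set S := Bᵀ * H p x l i i * B with hS
  obtain ⟨z, hz⟩ : ∃ z : Fin r → ℝ, B *ᵥ z = yi.ofLp :=
    ⟨b.repr ⟨yi, hyi⟩, by rw [hB, basisMatrix_mulVec_repr, b.sum_repr]⟩
  set c := Bᵀ *ᵥ (A p x l i k *ᵥ yk.ofLp) with hc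
  have hquad : ∀ z, z ⬝ᵥ (S *ᵥ z) = (B *ᵥ z) ⬝ᵥ (H p x l i i *ᵥ (B *ᵥ z)) := by
    intro z
    rw [hS, ← Matrix.mulVec_mulVec, ← Matrix.mulVec_mulVec, Matrix.dotProduct_mulVec,
      Matrix.vecMul_transpose]
  have hsymm : Sᵀ = S := by
    rw [hS, Matrix.transpose_mul, Matrix.transpose_mul, Matrix.transpose_transpose,
      show (H p x l i i)ᵀ = H p x l i i from hessL_self_transpose _ _ _ _, Matrix.mul_assoc]
  have hpos : ∀ z, z ≠ 0 → 0 < z ⬝ᵥ (S *ᵥ z) := by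
    intro z hz
    rw [hquad, basisMatrix_mulVec_repr]
    refine hi _ (Submodule.coe_mem _) fun h0 => hz ?_
    have h1 : ∑ c, z c • b c = 0 := by exact_mod_cast h0
    exact funext fun c => (Fintype.linearIndependent_iff.1 b.linearIndependent) z h1 c
  -- Minimize over y^i = Bz with weight α_{ik}; by definition of A_{ik} the term z·c collects both
  -- cross terms. The remainder cᵀS⁻¹c/(4α_{ik}) is α_{ki} times the Schur correction.
  have key := complete_square_nonneg hsymm hpos hik z c
  have h1 : z ⬝ᵥ (S *ᵥ z) = yi.ofLp ⬝ᵥ (H p x l i i *ᵥ yi.ofLp) := by rw [hquad, hz]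
  have h2 : z ⬝ᵥ c = yi.ofLp ⬝ᵥ (H p x l i k *ᵥ yk.ofLp) +
      yk.ofLp ⬝ᵥ (H p x l k i *ᵥ yi.ofLp) := by
    rw [hc, Matrix.dotProduct_mulVec, Matrix.vecMul_transpose, hz, A, Matrix.add_mulVec,
      dotProduct_add]
    congr 1
    rw [Matrix.dotProduct_mulVec, Matrix.vecMul_transpose, dotProduct_comm]
  have h3 : yk.ofLp ⬝ᵥ (schur p x l α i k B *ᵥ yk.ofLp) =
      yk.ofLp ⬝ᵥ (H p x l k k *ᵥ yk.ofLp) - 1 / (4 * α i k * α k i) * (c ⬝ᵥ (S⁻¹ *ᵥ c)) := by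
    rw [schur, Matrix.sub_mulVec, dotProduct_sub, Matrix.smul_mulVec, dotProduct_smul, smul_eq_mul]
    congr 2
    rw [← hS, hc]
    simp only [← Matrix.mulVec_mulVec]
    rw [Matrix.dotProduct_mulVec, Matrix.vecMul_transpose, Matrix.dotProduct_mulVec,
      ← Matrix.mulVec_transpose]
  rw [h3]
  rw [h1, h2] at key
  have h4 : α k i * (yk.ofLp ⬝ᵥ (H p x l k k *ᵥ yk.ofLp) -
      1 / (4 * α i k * α k i) * (c ⬝ᵥ (S⁻¹ *ᵥ c))) =
      α k i * (yk.ofLp ⬝ᵥ (H p x l k k *ᵥ yk.ofLp)) - 1 / (4 * α i k) * (c ⬝ᵥ (S⁻¹ *ᵥ c)) := by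
    field_simp
  rw [h4]
  linarith

/-- The Jacobian of the game is positive definite on the product of the subspaces `M^k`. -/
theorem sum_inner_hessOp_pos (p : G.Param) (x : G.Strategy) (l : G.Multiplier)
    (hSSOSC : ∀ k, SSOSC p x l k) (r : Fin G.N → ℕ)
    (b : ∀ k, Module.Basis (Fin (r k)) ℝ (M p x l k))
    (hα : ∃ α : Fin G.N → Fin G.N → ℝ,
      (∀ i j, j ≠ i → 0 < α i j) ∧
      (2 ≤ G.N → ∀ i, ∑ j ∈ Finset.univ.erase i, α i j = 1) ∧
      ∀ i k, i ≠ k → ∀ y ∈ M p x l k, y ≠ 0 →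
        0 < y.ofLp ⬝ᵥ (schur p x l α i k (basisMatrix (b i)) *ᵥ y.ofLp))
    (y : G.Strategy) (hy : ∀ k, y k ∈ M p x l k) (hy0 : y ≠ 0) :
    0 < ∑ k, ⟪y k, hessOp k x (l k) (w p k) y⟫_ℝ := by
  obtain ⟨α, hα0, hα1, hαS⟩ := hα
  obtain ⟨k₀, hk₀⟩ := Function.ne_iff.1 hy0
  set h : Fin G.N → Fin G.N → ℝ := fun k i => (y k).ofLp ⬝ᵥ (H p x l k i *ᵥ (y i).ofLp) with hh
  have e : ∑ k, ⟪y k, hessOp k x (l k) (w p k) y⟫_ℝ = ∑ k, ∑ i, h k i :=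
    Finset.sum_congr rfl fun k _ => inner_hessOp _ _ _ _ _ _
  rw [e]
  by_cases hN : 2 ≤ G.N
  · have hα1' := hα1 hN
    -- Summed over ordered pairs, the weights add up to 1 for each player and every term is met
    -- twice, so the φ(i, k) total twice the full quadratic form.
    set φ : Fin G.N → Fin G.N → ℝ := fun i k => α i k * h i i + α k i * h k k + (h i k + h k i)
    have hφ : ∀ i k, i ≠ k → 0 ≤ φ i k := by
      intro i k hik
      refine le_trans ?_ (pair_form_nonneg p x l (hSSOSC i) (b i) (hα0 i k hik.symm)
        (hα0 k i hik) (hy i) (y k))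
      refine mul_nonneg (hα0 k i hik).le ?_
      rcases eq_or_ne (y k) 0 with h0 | h0
      · simp [h0]
      · exact (hαS i k hik _ (hy k) h0).le
    obtain ⟨i₀, hi₀⟩ : ∃ i₀ : Fin G.N, i₀ ≠ k₀ :=
      have : Nontrivial (Fin G.N) := Fin.nontrivial_iff_two_le.2 hN
      exists_ne k₀
    -- Strictness comes from one pair whose second player k₀ has y^{k₀} ≠ 0, since the lower bound
    -- is a definite form in that component.
    have hφ0 : 0 < φ i₀ k₀ :=
      lt_of_lt_of_le (mul_pos (hα0 k₀ i₀ hi₀) (hαS i₀ k₀ hi₀ _ (hy k₀) hk₀))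
        (pair_form_nonneg p x l (hSSOSC i₀) (b i₀) (hα0 i₀ k₀ hi₀.symm)
          (hα0 k₀ i₀ hi₀) (hy i₀) (y k₀))
    have hsum : 0 < ∑ i, ∑ k ∈ Finset.univ.erase i, φ i k := by
      refine Finset.sum_pos' (fun i _ => Finset.sum_nonneg fun k hk =>
        hφ i k (Finset.ne_of_mem_erase hk).symm) ⟨i₀, Finset.mem_univ _, ?_⟩
      exact Finset.sum_pos' (fun k hk => hφ i₀ k (Finset.ne_of_mem_erase hk).symm)
        ⟨k₀, Finset.mem_erase.2 ⟨hi₀.symm, Finset.mem_univ _⟩, hφ0⟩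
    have hswap : ∀ ψ : Fin G.N → Fin G.N → ℝ, ∑ i, ∑ k ∈ Finset.univ.erase i, ψ i k =
        ∑ i, ∑ k ∈ Finset.univ.erase i, ψ k i := fun ψ =>
      Finset.sum_comm' (by simp [ne_comm])
    have hA : ∑ i, ∑ k ∈ Finset.univ.erase i, α i k * h i i = ∑ i, h i i := by
      refine Finset.sum_congr rfl fun i _ => ?_
      rw [← Finset.sum_mul, hα1' i, one_mul]
    have hall : ∑ k, ∑ i, h k i = ∑ i, h i i + ∑ i, ∑ k ∈ Finset.univ.erase i, h i k := by
      rw [← Finset.sum_add_distrib]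
      exact Finset.sum_congr rfl fun i _ => (Finset.add_sum_erase _ _ (Finset.mem_univ i)).symm
    have htot : ∑ i, ∑ k ∈ Finset.univ.erase i, φ i k = 2 * ∑ k, ∑ i, h k i := by
      simp only [φ, Finset.sum_add_distrib]
      rw [hswap fun i k => α k i * h k k, hswap fun i k => h k i, hA, hall]
      ring
    linarith
  · have hsub : Subsingleton (Fin G.N) := Fin.subsingleton_iff_le_one.2 (by omega)
    have h1 : ∀ k i, h k i = h k₀ k₀ := fun k i => by
      rw [Subsingleton.elim k k₀, Subsingleton.elim i k₀]
    have : Unique (Fin G.N) := ⟨⟨k₀⟩, fun _ => Subsingleton.elim _ _⟩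
    rw [Fintype.sum_unique, Fintype.sum_unique, h1]
    exact hSSOSC k₀ _ (hy k₀) hk₀

end NEP

end

/-! ### KKT conditions in coordinates and local minimality -/

noncomputable section

theorem mem_normalCone_multiplierCone_iff {m s : ℕ} (l η : EuclideanSpace ℝ (Fin m)) :
    η ∈ normalCone (multiplierCone m s) l ↔ ∀ i : Fin m, ((i : ℕ) < s → η i = 0) ∧
      (s ≤ (i : ℕ) → 0 ≤ l i ∧ η i ≤ 0 ∧ l i * η i = 0) := by
  constructor
  · rintro ⟨hl, hη⟩ i
    -- Test with l + t e_i: on free coordinates t = η_i forces η_i = 0; on the others t = 1 gives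
    -- the sign and t = -l_i the complementarity.
    have key : ∀ t : ℝ, (s ≤ (i : ℕ) → 0 ≤ l i + t) → t * η i ≤ 0 := by
      intro t ht
      have h := hη (l + EuclideanSpace.single i t) (fun j hj => by
        by_cases hji : j = i
        · subst hji; simpa using ht hj
        · simpa [hji] using hl j hj)
      rwa [add_sub_cancel_left, EuclideanSpace.inner_single_right] at h
    refine ⟨fun hi => ?_, fun hi => ?_⟩
    · have := key (η i) (fun h => absurd hi (not_lt.2 h))
      nlinarith [mul_self_nonneg (η i), mul_self_eq_zero.1 (le_antisymm this (mul_self_nonneg _))]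
    · have h0 := hl i hi
      have h1 : η i ≤ 0 := by simpa using key 1 (fun _ => by linarith)
      have h2 := key (-l i) (fun _ => by linarith)
      exact ⟨h0, h1, le_antisymm (mul_nonpos_of_nonneg_of_nonpos h0 h1) (by linarith)⟩
  · intro h
    refine ⟨fun i hi => ((h i).2 hi).1, fun y hy => ?_⟩
    rw [PiLp.inner_apply]
    refine Finset.sum_nonpos fun i _ => ?_
    simp only [PiLp.sub_apply, RCLike.inner_apply, conj_trivial]
    rcases lt_or_ge (i : ℕ) s with hi | hi
    · rw [(h i).1 hi, mul_zero]
    · obtain ⟨-, h1, h2⟩ := (h i).2 hi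
      nlinarith [mul_nonpos_of_nonneg_of_nonpos (hy i hi) h1]

namespace NEP

variable {G : NEP}

theorem mem_SKKT_iff (p : G.Param) (x : G.Strategy) (l : G.Multiplier) :
    (x, l) ∈ G.SKKT p ↔ ∀ k, gradL k x (l k) (w p k) - v p k = 0 ∧ ∀ i : Fin (G.m k),
      ((i : ℕ) < G.s k → G.g k i (x k) (w p k) - u p k i = 0) ∧
      (G.s k ≤ (i : ℕ) → 0 ≤ l k i ∧ G.g k i (x k) (w p k) - u p k i ≤ 0 ∧
        l k i * (G.g k i (x k) (w p k) - u p k i) = 0) := by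
  refine forall_congr' fun k => and_congr (by rw [sub_eq_zero, eq_comm]) ?_
  have : (∃ η ∈ normalCone (multiplierCone (G.m k) (G.s k)) (l k),
      -u p k = -constraintVec k (x k) (w p k) + η) ↔
      constraintVec k (x k) (w p k) - u p k ∈
        normalCone (multiplierCone (G.m k) (G.s k)) (l k) := by
    constructor
    · rintro ⟨η, hη, h⟩
      rwa [sub_eq_add_neg, h, add_neg_cancel_left]
    · exact fun h => ⟨_, h, by abel⟩
  rw [this, mem_normalCone_multiplierCone_iff]
  rfl

theorem hasGradientAt_lagrangian_update (k : Fin G.N) (x : G.Strategy)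
    (l : EuclideanSpace ℝ (Fin (G.m k))) (w : EuclideanSpace ℝ (Fin (G.d k)))
    (y : EuclideanSpace ℝ (Fin (G.n k))) :
    HasGradientAt (fun y => lagrangian k (Function.update x k y) l w)
      (gradL k (Function.update x k y) l w) y := by
  have h := ((contDiff_lagrangian_update k x l w).differentiable (by norm_num) y).hasGradientAt
  have e : gradL k (Function.update x k y) l w =
      ∇ (fun y => lagrangian k (Function.update x k y) l w) y := by simp [gradL]
  rwa [e]

theorem hasGradientAt_g (k : Fin G.N) (i : Fin (G.m k)) (w : EuclideanSpace ℝ (Fin (G.d k)))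
    (y : EuclideanSpace ℝ (Fin (G.n k))) :
    HasGradientAt (fun y => G.g k i y w) (gradgAt k i y w) y :=
  (hasFDerivAt_g k i w y).differentiableAt.hasGradientAt

/-- The augmented Lagrangian of player `k` with quadratic penalties for the constraints in `I`. -/
def augmented (k : Fin G.N) (ρ : ℝ) (I : Finset (Fin (G.m k)))
    (θ : G.Param × G.Strategy × G.Multiplier) (y : EuclideanSpace ℝ (Fin (G.n k))) : ℝ :=
  lagrangian k (Function.update θ.2.1 k y) (θ.2.2 k) (w θ.1 k) - ⟪v θ.1 k, y⟫_ℝ +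
    ∑ i ∈ I, ρ / 2 * (G.g k i y (w θ.1 k) - u θ.1 k i) ^ 2

/-- The gradient of the augmented Lagrangian in the strategy of player `k`. -/
def gradAugmented (k : Fin G.N) (ρ : ℝ) (I : Finset (Fin (G.m k)))
    (z : EuclideanSpace ℝ (Fin (G.n k)) × G.Param × G.Strategy × G.Multiplier) :
    EuclideanSpace ℝ (Fin (G.n k)) :=
  gradL k (Function.update z.2.2.1 k z.1) (z.2.2.2 k) (w z.2.1 k) - v z.2.1 k +
    ∑ i ∈ I, (ρ * (G.g k i z.1 (w z.2.1 k) - u z.2.1 k i)) • gradgAt k i z.1 (w z.2.1 k)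

theorem hasGradientAt_augmented (k : Fin G.N) (ρ : ℝ) (I : Finset (Fin (G.m k)))
    (θ : G.Param × G.Strategy × G.Multiplier) (y : EuclideanSpace ℝ (Fin (G.n k))) :
    HasGradientAt (augmented k ρ I θ) (gradAugmented k ρ I (y, θ)) y := by
  rw [hasGradientAt_iff_hasFDerivAt]
  have h1 := (hasGradientAt_lagrangian_update k θ.2.1 (θ.2.2 k) (w θ.1 k) y).hasFDerivAt
  have h2 : HasFDerivAt (fun y => ⟪v θ.1 k, y⟫_ℝ) (innerSL ℝ (v θ.1 k)) y :=
    (innerSL ℝ (v θ.1 k)).hasFDerivAt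
  have h3 := HasFDerivAt.fun_sum (u := I) fun i _ =>
    ((((hasGradientAt_g k i (w θ.1 k) y).hasFDerivAt.sub_const (u θ.1 k i)).pow 2).const_mul (ρ / 2))
  refine ((h1.sub h2).add h3).congr_fderiv ?_
  ext h
  simp [gradAugmented]
  refine Finset.sum_congr rfl fun i _ => ?_
  ring

theorem contDiff_u (k : Fin G.N) {n : WithTop ℕ∞} : ContDiff ℝ n (fun p : G.Param => u p k) :=
  contDiff_fst.comp (contDiff_coord k)

theorem contDiff_v (k : Fin G.N) {n : WithTop ℕ∞} : ContDiff ℝ n (fun p : G.Param => v p k) :=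
  (contDiff_fst.comp contDiff_snd).comp (contDiff_coord k)

theorem contDiff_w (k : Fin G.N) {n : WithTop ℕ∞} : ContDiff ℝ n (fun p : G.Param => w p k) :=
  (contDiff_snd.comp contDiff_snd).comp (contDiff_coord k)

theorem contDiff_gradAugmented (k : Fin G.N) (ρ : ℝ) (I : Finset (Fin (G.m k))) :
    ContDiff ℝ 1 (gradAugmented k ρ I) := by
  have hw : ContDiff ℝ 1 (fun z : EuclideanSpace ℝ (Fin (G.n k)) × G.Param × G.Strategy ×
      G.Multiplier => w z.2.1 k) := (contDiff_w k).comp (contDiff_fst.comp contDiff_snd)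
  have hu : ContDiff ℝ 1 (fun z : EuclideanSpace ℝ (Fin (G.n k)) × G.Param × G.Strategy ×
      G.Multiplier => u z.2.1 k) := (contDiff_u k).comp (contDiff_fst.comp contDiff_snd)
  have hv : ContDiff ℝ 1 (fun z : EuclideanSpace ℝ (Fin (G.n k)) × G.Param × G.Strategy ×
      G.Multiplier => v z.2.1 k) := (contDiff_v k).comp (contDiff_fst.comp contDiff_snd)
  have hup : ContDiff ℝ 1 (fun z : EuclideanSpace ℝ (Fin (G.n k)) × G.Param × G.Strategy ×
      G.Multiplier => Function.update z.2.2.1 k z.1) :=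
    ((contDiff_update k).of_le (by norm_num)).comp
      ((contDiff_fst.comp (contDiff_snd.comp contDiff_snd)).prodMk contDiff_fst)
  have hl : ContDiff ℝ 1 (fun z : EuclideanSpace ℝ (Fin (G.n k)) × G.Param × G.Strategy ×
      G.Multiplier => z.2.2.2 k) :=
    (contDiff_coord k).comp (contDiff_snd.comp (contDiff_snd.comp contDiff_snd))
  refine (((contDiff_gradL k).comp (hup.prodMk (hl.prodMk hw))).sub hv).add
    (ContDiff.sum fun i _ => ContDiff.smul (contDiff_const.mul (ContDiff.sub
      (((G.g_contDiff k i).of_le (by norm_num)).comp (contDiff_fst.prodMk hw))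
      (contDiff_euclidean.1 hu i))) ((contDiff_gradgAt k i).comp (contDiff_fst.prodMk hw)))

/-- Since the penalized constraints vanish at the point, the terms with second derivatives of g drop
out of the penalty, leaving rank-one terms. -/
theorem fderiv_gradAugmented_apply (k : Fin G.N) (ρ : ℝ) (I : Finset (Fin (G.m k)))
    (p : G.Param) (x : G.Strategy) (l : G.Multiplier)
    (hI : ∀ i ∈ I, G.g k i (x k) (w p k) - u p k i = 0) (h : EuclideanSpace ℝ (Fin (G.n k))) :
    fderiv ℝ (gradAugmented k ρ I) (x k, p, x, l) (h, 0) =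
      hessOp k x (l k) (w p k) (Pi.single k h) +
        ∑ i ∈ I, (ρ * ⟪gradgAt k i (x k) (w p k), h⟫_ℝ) • gradgAt k i (x k) (w p k) := by
  have h0 := (((contDiff_gradAugmented k ρ I).differentiable (by norm_num)
    (x k, p, x, l)).hasFDerivAt).comp (f := fun y => (y, p, x, l)) (x k)
    (hasFDerivAt_prodMk_left (𝕜 := ℝ) (x k) (p, x, l))
  have h1 := hasFDerivAt_gradL_update k k x (l k) (w p k)
  have hgg : ∀ i, HasFDerivAt (fun y => gradgAt k i y (w p k)) _ (x k) := fun i =>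
    (((contDiff_gradgAt k i).comp (f := fun y => (y, w p k))
      (contDiff_id.prodMk contDiff_const)).differentiable (by norm_num) (x k)).hasFDerivAt
  have h2 := HasFDerivAt.fun_sum (u := I) fun i _ =>
    (((hasGradientAt_g k i (w p k) (x k)).hasFDerivAt.sub_const (u p k i)).const_mul ρ).fun_smul (hgg i)
  have h3 := h0.unique ((h1.sub_const (v p k)).add h2)
  have h4 := DFunLike.congr_fun h3 h
  simp only [ContinuousLinearMap.comp_apply, ContinuousLinearMap.inl_apply] at h4
  rw [h4, _root_.add_apply, ContinuousLinearMap.comp_apply, pi_single_id_apply, _root_.sum_apply]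
  congr 1
  refine Finset.sum_congr rfl fun i hi => ?_
  simp [hI i hi]

/-- KKT points near a point satisfying the strong second-order condition of player `k` yield local
minimizers of the problem of player `k`. -/
theorem eventually_isLocalMinOn (p₀ : G.Param) (x₀ : G.Strategy) (l₀ : G.Multiplier)
    (hKKT : (x₀, l₀) ∈ G.SKKT p₀) (k : Fin G.N) (hk : SSOSC p₀ x₀ l₀ k) :
    ∀ᶠ z : G.Param × (G.Strategy × G.Multiplier) in 𝓝 (p₀, (x₀, l₀)), z.2 ∈ G.SKKT z.1 →
      IsLocalMinOn (objective z.1 z.2.1 k) (feasible z.1 k) (z.2.1 k) := by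
  classical
  rw [mem_SKKT_iff] at hKKT
  set I : Finset (Fin (G.m k)) := Finset.univ.filter (· ∈ I₁ p₀ x₀ l₀ k) with hI
  have hmem : ∀ i, i ∈ I ↔ i ∈ I₁ p₀ x₀ l₀ k := fun i => by simp [hI]
  have hI0 : ∀ i ∈ I, G.g k i (x₀ k) (w p₀ k) - u p₀ k i = 0 := by
    intro i hi
    rcases (hmem i).1 hi with h | h
    · exact ((hKKT k).2 i).1 h
    · exact h.2.2
  obtain ⟨ρ, hρ, c, hc, hpos⟩ := exists_augmented_pos
    ((hessOp k x₀ (l₀ k) (w p₀ k)).comp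
      (.pi (Pi.single k (.id ℝ (EuclideanSpace ℝ (Fin (G.n k)))))))
    (fun i => gradgAt k i (x₀ k) (w p₀ k)) I (fun y hy hy0 => by
      have h := hk y (fun i hi => hy i ((hmem i).2 hi)) hy0
      rw [ContinuousLinearMap.comp_apply, pi_single_id_apply,
        EuclideanSpace.inner_eq_star_dotProduct, ← hessL_mulVec, dotProduct_comm]
      simpa [H] using h)
  obtain ⟨r, hr, hmin⟩ := exists_ball_forall_le_of_gradient (Γ := gradAugmented k ρ I)
    (y₀ := x₀ k) (θ₀ := (p₀, x₀, l₀))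
    ((contDiff_gradAugmented k ρ I).contDiffAt.hasStrictFDerivAt (by norm_num)) hc (fun h => by
      refine (hpos h).trans (le_of_eq ?_)
      rw [fderiv_gradAugmented_apply k ρ I p₀ x₀ l₀ hI0, ContinuousLinearMap.comp_apply,
        pi_single_id_apply, inner_add_right, inner_sum, Finset.mul_sum]
      congr 1
      refine Finset.sum_congr rfl fun i _ => ?_
      rw [inner_smul_right, real_inner_comm]
      ring)
  have hball : ∀ᶠ z : G.Param × (G.Strategy × G.Multiplier) in 𝓝 (p₀, (x₀, l₀)),
      z.2.1 k ∈ Metric.ball (x₀ k) r :=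
    (by fun_prop : Continuous fun z : G.Param × (G.Strategy × G.Multiplier) => z.2.1 k).continuousAt
      (Metric.ball_mem_nhds _ hr)
  -- Positive multipliers stay positive, so complementarity keeps the inequalities in I tight at
  -- nearby KKT points, where the penalty gradients therefore vanish.
  have hlpos : ∀ᶠ z : G.Param × (G.Strategy × G.Multiplier) in 𝓝 (p₀, (x₀, l₀)),
      ∀ i, 0 < l₀ k i → 0 < z.2.2 k i := by
    refine eventually_all.2 fun i => ?_
    by_cases h : 0 < l₀ k i
    · filter_upwards [(by fun_prop : Continuous
        fun z : G.Param × (G.Strategy × G.Multiplier) => z.2.2 k i).continuousAt.eventually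
          (lt_mem_nhds h)] with z hz _ using hz
    · exact Eventually.of_forall fun z h' => absurd h' h
  filter_upwards [hmin, hball, hlpos] with z hz hzball hzl hzKKT
  obtain ⟨p, x, l⟩ := z
  simp only at hz hzball hzl hzKKT ⊢
  rw [mem_SKKT_iff] at hzKKT
  obtain ⟨hgrad, hcomp⟩ := hzKKT k
  have hc0 : ∀ i ∈ I, G.g k i (x k) (w p k) - u p k i = 0 := by
    intro i hi
    rcases (hmem i).1 hi with h | h
    · exact (hcomp i).1 h
    · exact (mul_eq_zero.1 ((hcomp i).2 h.1).2.2).resolve_left (hzl i h.2.1).ne'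
  have hle := hz (augmented k ρ I (p, x, l)) (hasGradientAt_augmented k ρ I (p, x, l)) (x k) hzball
    (by
      simp only [gradAugmented, Function.update_eq_self, hgrad, zero_add]
      exact Finset.sum_eq_zero fun i hi => by rw [hc0 i hi, mul_zero, zero_smul])
  have hsplit : ∀ y, augmented k ρ I (p, x, l) y = objective p x k y + ∑ i, l k i * u p k i +
      ∑ i, (l k i * (G.g k i y (w p k) - u p k i) +
        if i ∈ I then ρ / 2 * (G.g k i y (w p k) - u p k i) ^ 2 else 0) := by
    intro y
    simp only [augmented, objective, lagrangian, Function.update_self, Finset.sum_add_distrib,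
      mul_sub, Finset.sum_sub_distrib, Finset.sum_ite_mem, Finset.univ_inter]
    ring
  have hx : augmented k ρ I (p, x, l) (x k) = objective p x k (x k) + ∑ i, l k i * u p k i := by
    rw [hsplit, add_eq_left]
    refine Finset.sum_eq_zero fun i _ => ?_
    by_cases hi : i ∈ I
    · simp [hc0 i hi]
    · have hs : G.s k ≤ (i : ℕ) := not_lt.1 fun h => hi ((hmem i).2 (Or.inl h))
      rw [if_neg hi, ((hcomp i).2 hs).2.2, add_zero]
  -- For a slack s ≤ 0 the added terms factor as s(λ_i + (ρ/2)s); near x^k the second factor is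
  -- positive, so they are nonpositive.
  have hev : ∀ᶠ y in 𝓝 (x k), ∀ i ∈ I, G.s k ≤ (i : ℕ) →
      0 < l k i + ρ / 2 * (G.g k i y (w p k) - u p k i) := by
    rw [Filter.eventually_all_finset]
    intro i hi
    by_cases hs : G.s k ≤ (i : ℕ)
    · have hcont : ContinuousAt (fun y => l k i + ρ / 2 * (G.g k i y (w p k) - u p k i)) (x k) :=
        continuousAt_const.add (continuousAt_const.mul
          ((hasFDerivAt_g k i (w p k) (x k)).continuousAt.sub continuousAt_const))
      have h0 : 0 < l k i + ρ / 2 * (G.g k i (x k) (w p k) - u p k i) := by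
        rw [hc0 i hi, mul_zero, add_zero]
        rcases (hmem i).1 hi with h | h
        · exact absurd h (not_lt.2 hs)
        · exact hzl i h.2.1
      filter_upwards [hcont.eventually (lt_mem_nhds h0)] with y hy _ using hy
    · exact Eventually.of_forall fun y h => absurd h hs
  refine eventually_nhdsWithin_iff.2 ?_
  filter_upwards [hev, Metric.isOpen_ball.mem_nhds hzball] with y hy hyball hyfeas
  have h1 := hle y hyball
  rw [hx, hsplit] at h1
  have h2 : ∑ i, (l k i * (G.g k i y (w p k) - u p k i) +
        if i ∈ I then ρ / 2 * (G.g k i y (w p k) - u p k i) ^ 2 else 0) ≤ 0 := by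
    refine Finset.sum_nonpos fun i _ => ?_
    rcases lt_or_ge (i : ℕ) (G.s k) with hs | hs
    · rw [(hyfeas i).1 hs]; simp
    · have h3 : G.g k i y (w p k) - u p k i ≤ 0 := sub_nonpos.2 ((hyfeas i).2 hs)
      by_cases hi : i ∈ I
      · rw [if_pos hi]
        have := mul_nonpos_of_nonneg_of_nonpos (hy i hi hs).le h3
        linarith [this]
      · rw [if_neg hi, add_zero]
        exact mul_nonpos_of_nonneg_of_nonpos ((hcomp i).2 hs).1 h3
  linarith

end NEP

end

/-! ### The slack formulation of the KKT system and its linearization -/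

noncomputable section

namespace NEP

variable {G : NEP}

/-- The residual of the KKT system with the constraint slacks as additional variables. -/
def kktResidual (z : G.Param × (G.Strategy × G.Multiplier × G.Multiplier)) :
    G.Strategy × G.Multiplier :=
  (fun k => gradL k z.2.1 (z.2.2.1 k) (w z.1 k) - v z.1 k,
   fun k => constraintVec k (z.2.1 k) (w z.1 k) - u z.1 k - z.2.2.2 k)

theorem contDiff_slack (k : Fin G.N) : ContDiff ℝ 2 (fun z : G.Param × G.Strategy =>
    constraintVec k (z.2 k) (w z.1 k) - u z.1 k) := by
  refine ContDiff.sub (contDiff_euclidean.2 fun i => ?_) ((contDiff_u k).comp contDiff_fst)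
  exact (G.g_contDiff k i).comp (f := fun z : G.Param × G.Strategy => (z.2 k, w z.1 k))
    (((contDiff_coord k).comp contDiff_snd).prodMk
    ((contDiff_w k).comp contDiff_fst))

theorem contDiff_kktResidual : ContDiff ℝ 1 (kktResidual (G := G)) := by
  refine ContDiff.prodMk (contDiff_pi.2 fun k => ?_) (contDiff_pi.2 fun k => ?_)
  · refine ContDiff.sub ?_ ((contDiff_v k).comp contDiff_fst)
    exact (contDiff_gradL k).comp
      (f := fun z : G.Param × (G.Strategy × G.Multiplier × G.Multiplier) =>
        (z.2.1, z.2.2.1 k, w z.1 k)) ((contDiff_fst.comp contDiff_snd).prodMk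
      (((contDiff_coord k).comp (contDiff_fst.comp (contDiff_snd.comp contDiff_snd))).prodMk
        ((contDiff_w k).comp contDiff_fst)))
  · refine ContDiff.sub ?_ ((contDiff_coord k).comp
      (contDiff_snd.comp (contDiff_snd.comp contDiff_snd)))
    exact ((contDiff_slack k).of_le (by norm_num)).comp
      (contDiff_fst.prodMk (contDiff_fst.comp contDiff_snd))

/-- The derivative of the KKT residual in the strategies, multipliers and slacks. -/
def kktLinearization (p : G.Param) (q : G.Strategy × G.Multiplier × G.Multiplier) :
    (G.Strategy × G.Multiplier × G.Multiplier) →L[ℝ] G.Strategy × G.Multiplier :=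
  (fderiv ℝ kktResidual (p, q)).comp (ContinuousLinearMap.inr ℝ _ _)

theorem hasFDerivAt_kktResidual (p : G.Param) (q : G.Strategy × G.Multiplier × G.Multiplier) :
    HasFDerivAt (fun q => kktResidual (p, q)) (kktLinearization p q) q :=
  ((contDiff_kktResidual.differentiable (by norm_num) (p, q)).hasFDerivAt).comp
    (f := fun q => (p, q)) q (hasFDerivAt_prodMk_right (𝕜 := ℝ) p q)

theorem kktLinearization_fst (p : G.Param) (q h : G.Strategy × G.Multiplier × G.Multiplier)
    (k : Fin G.N) : (kktLinearization p q h).1 k = hessOp k q.1 (q.2.1 k) (w p k) h.1 +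
      ∑ i, h.2.1 k i • gradgAt k i (q.1 k) (w p k) := by
  have h0 : HasFDerivAt
      (fun q : G.Strategy × G.Multiplier × G.Multiplier => (kktResidual (p, q)).1 k) _ q :=
    ((ContinuousLinearMap.proj (R := ℝ) (φ := fun j => EuclideanSpace ℝ (Fin (G.n j))) k).comp
      (ContinuousLinearMap.fst ℝ G.Strategy G.Multiplier)).hasFDerivAt.comp q
      (hasFDerivAt_kktResidual p q)
  -- Write ∇L at the moving multipliers as ∇L at the fixed ones plus ∑ (λ'_i - λ_i)∇g_i. The
  -- coefficients vanish at q, so no derivative of ∇g_i survives in the second part.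
  have h1 : HasFDerivAt (fun q' : G.Strategy × G.Multiplier × G.Multiplier =>
      gradL k q'.1 (q.2.1 k) (w p k)) _ q :=
    (hasFDerivAt_gradL k q.1 (q.2.1 k) (w p k)).comp q hasFDerivAt_fst
  have h2 : ∀ i, HasFDerivAt (fun q' : G.Strategy × G.Multiplier × G.Multiplier =>
      gradgAt k i (q'.1 k) (w p k)) _ q := fun i =>
    (((contDiff_gradgAt k i).comp
      (f := fun q' : G.Strategy × G.Multiplier × G.Multiplier => (q'.1 k, w p k))
      (((contDiff_coord k).comp contDiff_fst).prodMk contDiff_const)).differentiable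
        (by norm_num) q).hasFDerivAt
  let Λ : Fin (G.m k) → (G.Strategy × G.Multiplier × G.Multiplier) →L[ℝ] ℝ := fun i =>
    (PiLp.proj 2 (𝕜 := ℝ) (fun _ : Fin (G.m k) => ℝ) i).comp
      ((ContinuousLinearMap.proj (R := ℝ) (φ := fun j => EuclideanSpace ℝ (Fin (G.m j))) k).comp
        ((ContinuousLinearMap.fst ℝ G.Multiplier G.Multiplier).comp
          (ContinuousLinearMap.snd ℝ G.Strategy _)))
  have h3 : ∀ i, HasFDerivAt (fun q' : G.Strategy × G.Multiplier × G.Multiplier =>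
      q'.2.1 k i - q.2.1 k i) (Λ i) q := fun i => (Λ i).hasFDerivAt.sub_const _
  have h4 := (h1.add (HasFDerivAt.fun_sum (u := Finset.univ) fun i _ =>
    (h3 i).fun_smul (h2 i))).sub_const (v p k)
  have h5 := h0.unique (h4.congr_of_eventuallyEq (Eventually.of_forall fun q' => by
    simp only [kktResidual, gradL_eq, Pi.add_apply, sub_smul, Finset.sum_sub_distrib]
    abel))
  have h6 := DFunLike.congr_fun h5 h
  simpa [Λ] using h6

theorem kktLinearization_snd (p : G.Param) (q h : G.Strategy × G.Multiplier × G.Multiplier)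
    (k : Fin G.N) (i : Fin (G.m k)) : (kktLinearization p q h).2 k i =
      ⟪gradgAt k i (q.1 k) (w p k), h.1 k⟫_ℝ - h.2.2 k i := by
  have h0 : HasFDerivAt
      (fun q : G.Strategy × G.Multiplier × G.Multiplier => (kktResidual (p, q)).2 k i) _ q :=
    ((PiLp.proj 2 (𝕜 := ℝ) (fun _ : Fin (G.m k) => ℝ) i).comp
      ((ContinuousLinearMap.proj (R := ℝ) (φ := fun j => EuclideanSpace ℝ (Fin (G.m j))) k).comp
      (ContinuousLinearMap.snd ℝ G.Strategy G.Multiplier))).hasFDerivAt.comp q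
      (hasFDerivAt_kktResidual p q)
  let Λ : (G.Strategy × G.Multiplier × G.Multiplier) →L[ℝ] ℝ :=
    (PiLp.proj 2 (𝕜 := ℝ) (fun _ : Fin (G.m k) => ℝ) i).comp
      ((ContinuousLinearMap.proj (R := ℝ) (φ := fun j => EuclideanSpace ℝ (Fin (G.m j))) k).comp
        ((ContinuousLinearMap.snd ℝ G.Multiplier G.Multiplier).comp
          (ContinuousLinearMap.snd ℝ G.Strategy _)))
  have h1 : HasFDerivAt (fun q' : G.Strategy × G.Multiplier × G.Multiplier =>
      G.g k i (q'.1 k) (w p k)) _ q :=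
    (hasGradientAt_g k i (w p k) (q.1 k)).hasFDerivAt.comp
      (f := fun q' : G.Strategy × G.Multiplier × G.Multiplier => q'.1 k) q
      ((ContinuousLinearMap.proj (R := ℝ) (φ := fun j => EuclideanSpace ℝ (Fin (G.n j))) k).comp
        (ContinuousLinearMap.fst ℝ G.Strategy (G.Multiplier × G.Multiplier))).hasFDerivAt
  have h2 := (h1.sub_const (u p k i)).sub Λ.hasFDerivAt
  have h6 := DFunLike.congr_fun (h0.unique h2) h
  simpa [Λ] using h6

/-- The constraint slacks `G^k(x^k; w^k) - u^k`. -/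
def slack (z : G.Param × G.Strategy) : G.Multiplier :=
  fun k => constraintVec k (z.2 k) (w z.1 k) - u z.1 k

theorem slack_apply (p : G.Param) (x : G.Strategy) (k : Fin G.N) (i : Fin (G.m k)) :
    slack (p, x) k i = G.g k i (x k) (w p k) - u p k i := rfl

theorem continuous_slack : Continuous (slack (G := G)) :=
  continuous_pi fun k => (contDiff_slack k).continuous

/-- Near a KKT point, complementarity is membership in a translated cone. -/
theorem eventually_sub_mem_complementarityCone_iff (p₀ : G.Param) (x₀ : G.Strategy)
    (l₀ : G.Multiplier) (hKKT : (x₀, l₀) ∈ G.SKKT p₀) :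
    ∀ᶠ q : G.Strategy × G.Multiplier × G.Multiplier in 𝓝 (x₀, l₀, slack (p₀, x₀)),
      (q - (x₀, l₀, slack (p₀, x₀)) ∈ complementarityCone G.Strategy (I₁ p₀ x₀ l₀)
          (fun k => (activeSet p₀ x₀ k)ᶜ) ↔
        ∀ k, ∀ i : Fin (G.m k), ((i : ℕ) < G.s k → q.2.2 k i = 0) ∧
          (G.s k ≤ (i : ℕ) → 0 ≤ q.2.1 k i ∧ q.2.2 k i ≤ 0 ∧ q.2.1 k i * q.2.2 k i = 0)) := by
  rw [mem_SKKT_iff] at hKKT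
  have h1 : ∀ᶠ q : G.Strategy × G.Multiplier × G.Multiplier in 𝓝 (x₀, l₀, slack (p₀, x₀)),
      ∀ k i, 0 < l₀ k i → 0 < q.2.1 k i := by
    refine eventually_all.2 fun k => eventually_all.2 fun i => ?_
    by_cases h : 0 < l₀ k i
    · filter_upwards [(by fun_prop : Continuous fun q : G.Strategy × G.Multiplier × G.Multiplier =>
        q.2.1 k i).continuousAt.eventually (lt_mem_nhds h)] with z hz _ using hz
    · exact Eventually.of_forall fun z h' => absurd h' h
  have h2 : ∀ᶠ q : G.Strategy × G.Multiplier × G.Multiplier in 𝓝 (x₀, l₀, slack (p₀, x₀)),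
      ∀ k i, slack (p₀, x₀) k i < 0 → q.2.2 k i < 0 := by
    refine eventually_all.2 fun k => eventually_all.2 fun i => ?_
    by_cases h : slack (p₀, x₀) k i < 0
    · filter_upwards [(by fun_prop : Continuous fun q : G.Strategy × G.Multiplier × G.Multiplier =>
        q.2.2 k i).continuousAt.eventually (gt_mem_nhds h)] with z hz _ using hz
    · exact Eventually.of_forall fun z h' => absurd h' h
  filter_upwards [h1, h2] with q hq1 hq2
  refine forall_congr' fun k => forall_congr' fun i => ?_
  have hk := (hKKT k).2 i
  rw [← slack_apply] at hk
  have hq1 := hq1 k i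
  have hq2 := hq2 k i
  have hI : i ∈ I₁ p₀ x₀ l₀ k ↔ (i : ℕ) < G.s k ∨
      (G.s k ≤ (i : ℕ) ∧ 0 < l₀ k i ∧ slack (p₀, x₀) k i = 0) := Iff.rfl
  have hJ : i ∈ (activeSet p₀ x₀ k)ᶜ ↔ ¬ ((i : ℕ) < G.s k ∨ slack (p₀, x₀) k i = 0) := by
    rw [slack_apply, sub_eq_zero]; rfl
  simp only [Prod.snd_sub, Prod.fst_sub, Pi.sub_apply, PiLp.sub_apply]
  rw [hI, hJ]
  generalize slack (p₀, x₀) k i = e₀ at *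
  generalize l₀ k i = a₀ at *
  generalize q.2.1 k i = a at *
  generalize q.2.2 k i = e at *
  -- The cases are: equality, then for inequalities zero multiplier with zero slack (the cone is the
  -- condition itself), inactive (e < 0 forces λ = 0), and strongly active (λ > 0 forces e = 0).
  rcases lt_or_ge (i : ℕ) (G.s k) with hs | hs
  · have := hk.1 hs
    subst this
    simp [hs, hs.not_ge]
  · obtain ⟨ha, he, hae⟩ := hk.2 hs
    rcases ha.eq_or_lt with ha | ha
    · subst ha
      rcases he.eq_or_lt with he | he
      · subst he
        simp [hs, hs.not_gt]
      · have := hq2 he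
        simp only [hs.not_gt, hs, he.ne, lt_irrefl, and_false, or_false, not_false_eq_true,
          false_imp_iff, true_imp_iff, true_and, not_true_eq_false, sub_zero, and_true]
        constructor
        · rintro rfl
          simp [this.le]
        · rintro ⟨-, -, h⟩
          exact (mul_eq_zero.1 h).resolve_right this.ne
    · have he0 : e₀ = 0 := (mul_eq_zero.1 hae).resolve_left ha.ne'
      subst he0
      have := hq1 ha
      simp only [hs.not_gt, hs, ha, and_true, or_true, not_true_eq_false, true_imp_iff,
        false_imp_iff, true_and, sub_zero]
      constructor
      · rintro rfl
        simp [this.le]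
      · rintro ⟨-, -, h⟩
        exact (mul_eq_zero.1 h).resolve_left this.ne'

/-- With the slack determined by (p, x), the second residual vanishes identically, so adding the
slack as an unknown changes nothing. -/
theorem mem_SKKT_iff_kktResidual (p : G.Param) (x : G.Strategy) (l : G.Multiplier) :
    (x, l) ∈ G.SKKT p ↔ kktResidual (p, x, l, slack (p, x)) = 0 ∧
      ∀ k, ∀ i : Fin (G.m k), ((i : ℕ) < G.s k → slack (p, x) k i = 0) ∧
          (G.s k ≤ (i : ℕ) → 0 ≤ l k i ∧ slack (p, x) k i ≤ 0 ∧ l k i * slack (p, x) k i = 0) := by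
  have h : kktResidual (p, x, l, slack (p, x)) = 0 ↔
      ∀ k, gradL k x (l k) (w p k) - v p k = 0 := by
    simp only [kktResidual, slack, sub_self, Prod.mk_eq_zero, funext_iff, Pi.zero_apply,
      implies_true, and_true]
  rw [mem_SKKT_iff, h, forall_and]
  rfl

end NEP

end

/-! ### Strong regularity and local Nash equilibria -/

theorem mainTheorem2 (G : NEP) (p₀ : G.Param) (x₀ : G.Strategy) (l₀ : G.Multiplier)
    (hKKT : (x₀, l₀) ∈ G.SKKT p₀)
    (hLICQ : ∀ k, NEP.LICQ p₀ x₀ k)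
    (hSSOSC : ∀ k, NEP.SSOSC p₀ x₀ l₀ k)
    (r : Fin G.N → ℕ)
    (b : ∀ k, Module.Basis (Fin (r k)) ℝ (NEP.M p₀ x₀ l₀ k))
    (hα : ∃ α : Fin G.N → Fin G.N → ℝ,
      (∀ i j, j ≠ i → 0 < α i j) ∧
      (2 ≤ G.N → ∀ i, ∑ j ∈ Finset.univ.erase i, α i j = 1) ∧
      ∀ i k, i ≠ k → ∀ y ∈ NEP.M p₀ x₀ l₀ k, y ≠ 0 →
        0 < y.ofLp ⬝ᵥ (NEP.schur p₀ x₀ l₀ α i k (NEP.basisMatrix (b i)) *ᵥ y.ofLp)) :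
    StronglyRegular G.SKKT p₀ (x₀, l₀) ∧
      ∀ᶠ z : G.Param × (G.Strategy × G.Multiplier) in 𝓝 (p₀, (x₀, l₀)),
        z.2 ∈ G.SKKT z.1 → NEP.IsLocalNash z.1 z.2.1 := by
  classical
  refine ⟨⟨hKKT, ?_⟩, ?_⟩
  · set e₀ := NEP.slack (p₀, x₀) with he₀
    obtain ⟨hN₀, hcompl₀⟩ := (NEP.mem_SKKT_iff_kktResidual p₀ x₀ l₀).1 hKKT
    obtain ⟨Ψ, K, hK, hΨ, hΨC, hTΨ, hΨT⟩ := exists_lipschitz_inverse_on_complementarityCone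
      (fun k => NEP.hessOp k x₀ (l₀ k) (NEP.w p₀ k))
      (fun k i => NEP.gradgAt k i (x₀ k) (NEP.w p₀ k))
      (NEP.kktLinearization p₀ (x₀, l₀, e₀))
      (fun q k => NEP.kktLinearization_fst p₀ (x₀, l₀, e₀) q k)
      (fun q k j => NEP.kktLinearization_snd p₀ (x₀, l₀, e₀) q k j)
      (NEP.I₁ p₀ x₀ l₀) (fun k => (NEP.activeSet p₀ x₀ k)ᶜ)
      (fun k μ hμ hsum => by
        have hli := Fintype.linearIndependent_iff.1 (hLICQ k) (fun i => μ i) (by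
          rw [← hsum, ← Fintype.sum_subtype_add_sum_subtype (· ∈ NEP.activeSet p₀ x₀ k)]
          symm
          refine (add_eq_left.2 (Finset.sum_eq_zero fun j _ => ?_)).trans ?_
          · rw [hμ j j.2, zero_smul]
          · rfl)
        ext j
        by_cases hj : j ∈ NEP.activeSet p₀ x₀ k
        · exact hli ⟨j, hj⟩
        · exact hμ j hj)
      (fun y hy hy0 => NEP.sum_inner_hessOp_pos p₀ x₀ l₀ hSSOSC r b hα y hy hy0)
      (fun k j hj hj' => hj' (hj.imp id fun h => sub_eq_zero.1 h.2.2))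
    obtain ⟨U, hU, V, hV, hVW, σ, hσ, L, hL⟩ := exists_lipschitz_localization
      (NEP.contDiff_kktResidual.contDiffAt.hasStrictFDerivAt (by norm_num)) hN₀ hK hΨ hΨC hTΨ hΨT
      (by intro k j; simp) (NEP.eventually_sub_mem_complementarityCone_iff p₀ x₀ l₀ hKKT)
    have hσ₀ : σ p₀ = (x₀, l₀, e₀) := by
      have h : (x₀, l₀, e₀) ∈ ({σ p₀} : Set _) := by
        rw [← hσ p₀ (mem_of_mem_nhds hU)]
        refine ⟨⟨?_, hN₀⟩, mem_of_mem_nhds hV⟩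
        rw [sub_self]
        intro k j; simp
      exact h.symm
    have hσmem : ∀ p ∈ U, ((σ p).1, (σ p).2.1) ∈ G.SKKT p ∧
        (σ p).2.2 = NEP.slack (p, (σ p).1) := by
      intro p hp
      have h : σ p ∈ ({σ p} : Set _) := rfl
      rw [← hσ p hp] at h
      have hs : (σ p).2.2 = NEP.slack (p, (σ p).1) := by
        have h2 := congrArg Prod.snd h.1.2
        exact (sub_eq_zero.1 h2).symm
      refine ⟨?_, hs⟩
      rw [NEP.mem_SKKT_iff_kktResidual, ← hs]
      exact ⟨h.1.2, (hVW h.2).1 h.1.1⟩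
    -- Passing back from (x, λ, e) to (x, λ): the slack is continuous in (p, x), so (p, x, λ) near
    -- the reference point lifts into `V`, and uniqueness there applies.
    have hcont : ∀ᶠ z : G.Param × (G.Strategy × G.Multiplier) in 𝓝 (p₀, (x₀, l₀)),
        (z.2.1, z.2.2, NEP.slack (z.1, z.2.1)) ∈ V := by
      have hc : Continuous fun z : G.Param × (G.Strategy × G.Multiplier) =>
          (z.2.1, z.2.2, NEP.slack (z.1, z.2.1)) := by
        have := (NEP.continuous_slack (G := G)).comp (continuous_fst.prodMk
          (continuous_fst.comp continuous_snd) :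
            Continuous fun z : G.Param × (G.Strategy × G.Multiplier) => (z.1, z.2.1))
        exact (continuous_fst.comp continuous_snd).prodMk
          ((continuous_snd.comp continuous_snd).prodMk this)
      exact hc.continuousAt hV
    rw [nhds_prod_eq, Filter.eventually_prod_iff] at hcont
    obtain ⟨P, hP, P', hP', hPP'⟩ := hcont
    have hσc : ContinuousAt (fun p => ((σ p).1, (σ p).2.1)) p₀ := by
      have h1 := (hL.continuousOn.continuousAt hU)
      exact h1.fst.prodMk h1.snd.fst
    -- The parameter neighbourhood is shrunk so that the localized solution remains in the smaller
    -- neighbourhood of (x₀, λ₀).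
    have hσP' : ∀ᶠ p in 𝓝 p₀, P' ((σ p).1, (σ p).2.1) := by
      have h : (fun p => ((σ p).1, (σ p).2.1)) p₀ = (x₀, l₀) := by simp only [hσ₀]
      exact hσc.eventually (h.symm ▸ hP')
    refine ⟨U ∩ {p | P p ∧ P' ((σ p).1, (σ p).2.1)}, inter_mem hU (hP.and hσP'), {z | P' z}, hP',
      fun p => ((σ p).1, (σ p).2.1), ?_, L, ?_⟩
    · rintro p ⟨hpU, hpP, hpP'⟩
      ext ⟨x, l⟩
      simp only [Set.mem_inter_iff, Set.mem_ofPred_eq, Set.mem_singleton_iff]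
      constructor
      · rintro ⟨hxl, hxlP⟩
        have hqV := hPP' hpP hxlP
        obtain ⟨hres, hcompl⟩ := (NEP.mem_SKKT_iff_kktResidual p x l).1 hxl
        have h : (x, l, NEP.slack (p, x)) ∈ ({σ p} : Set _) := by
          rw [← hσ p hpU]
          exact ⟨⟨(hVW hqV).2 hcompl, hres⟩, hqV⟩
        rw [← Set.mem_singleton_iff.1 h]
      · intro h
        rw [h]
        exact ⟨(hσmem p hpU).1, hpP'⟩
    · have h1 : LipschitzWith 1 fun q : G.Strategy × G.Multiplier × G.Multiplier =>
          (q.1, q.2.1) := by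
        simpa using LipschitzWith.prod_fst.prodMk (LipschitzWith.prod_fst.comp LipschitzWith.prod_snd)
      have h2 := (h1.comp_lipschitzOnWith hL).mono (Set.inter_subset_left
        (t := {p | P p ∧ P' ((σ p).1, (σ p).2.1)}))
      rwa [one_mul] at h2
  · have h := eventually_all.2 fun k =>
      NEP.eventually_isLocalMinOn p₀ x₀ l₀ hKKT k (hSSOSC k)
    filter_upwards [h] with z hz hzK k
    refine ⟨?_, hz k hzK⟩
    obtain ⟨p, x, l⟩ := z
    intro i
    have hi := ((NEP.mem_SKKT_iff p x l).1 hzK k).2 i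
    exact ⟨fun h => sub_eq_zero.1 (hi.1 h), fun h => sub_nonpos.1 (hi.2 h).2.1⟩
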